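/- **Theorem (Discrete spectrum of resonances).** Let $S^1=\mathbb R/\mathbb Z$, let $g:\mathbb R\to\mathbb R$ be a $C^\infty$ diffeomorphism with $g(x+1)=g(x)+1$, let $k\ge 2$ be an integer, and let $E:S^1\to S^1$, $E(x)=k\,g(x) \bmod 1$. Put $E_{\min}:=\min_x E'(x)=k\min_x g'(x)$ and assume $E_{\min}>1$. Let $\tau:S^1\to\mathbb R$ be $C^\infty$ and $\nu\in\mathbb R$. Let $\hat F_\nu$ be the transfer operator $$\hat F_\nu\varphi=e^{i\nu\tau}\cdot(\varphi\circ E),$$ extended from $C^\infty(S^1)$ to the distributions $\mathcal D'(S^1)$ by duality, i.e. $\langle \hat F_\nu\alpha,\varphi\rangle=\langle\alpha,\hat F_\nu^{t}\varphi\rangle$ for $\varphi\in C^\infty(S^1)$, where $(\hat F_\nu^{t}\varphi)(y)=\sum_{x\in E^{-1}(y)}\frac{e^{i\nu\tau(x)}}{E'(x)}\varphi(x)$. For $m\in\mathbb R$ let $H^m(S^1)$ be the space of the $\alpha\in\mathcal D'(S^1)$ with $\|\alpha\|_{H^m}^2:=\sum_{\xi\in\mathbb Z}(1+\xi^2)^{m}|\hat\alpha(\xi)|^2<\infty$,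 where $\hat\alpha(\xi)=\langle\alpha,e^{-2\pi i\xi x}\rangle$. For $m<0$ put $$r_m:=\frac{1}{E_{\min}^{|m|}}\sqrt{\frac{k}{E_{\min}}}.$$ 1. For every $m<0$, $\hat F_\nu$ leaves $H^m(S^1)$ invariant, $\hat F_\nu:H^m(S^1)\to H^m(S^1)$ is bounded, and it can be written $\hat F_\nu=\hat R+\hat K$ with bounded operators $\hat R,\hat K$ on $H^m(S^1)$ such that $\hat K$ is compact and $\|\hat R\|\le r_m$. 2. Consequently, for every $m<0$, the essential spectral radius of $\hat F_\nu$ on $H^m(S^1)$ (the supremum of the $|\lambda|$ such that $\hat F_\nu-\lambda$ is not Fredholm) is at most $r_m$, and the spectrum in $\{|\lambda|>r_m\}$ is discrete (possibly empty): each of its points is an isolated point of the spectrum and an eigenvalue with a finite-dimensional generalized eigenspace, and for every $\rho>r_m$ only finitely many of them satisfy $|\lambda|\ge\rho$. These eigenvalues are called Ruelle resonances. 3. The resonances and their generalized eigenspaces do not depend on $m$: for $m,m'<0$ and $|\lambda|>\max(r_m,r_{m'})$, $\lambda$ is in the spectrum of $\hat F_\nu$ on $H^m(S^1)$ if and only if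 it is in the spectrum of $\hat F_\nu$ on $H^{m'}(S^1)$, and the generalized eigenspaces $\bigcup_n\ker(\hat F_\nu-\lambda)^n$ in $H^m(S^1)$ and in $H^{m'}(S^1)$ are the same subspace of $\mathcal D'(S^1)$. -/

import Mathlib

open scoped ContDiff Manifold ENNReal
open MeasureTheory

noncomputable section

namespace Ruelle

/-! ### Smooth functions, distributions and Sobolev spaces on the circle `ℝ / ℤ` -/

/-- `C^∞(S¹)` for `S¹ = ℝ / ℤ`: the smooth `1`-periodic functions `ℝ → ℂ`. -/
def SmoothCircle : Submodule ℂ (ℝ → ℂ) where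
  carrier := {φ | ContDiff ℝ ∞ φ ∧ Function.Periodic φ 1}
  add_mem' ha hb := ⟨ha.1.add hb.1, ha.2.add hb.2⟩
  zero_mem' := ⟨contDiff_const, fun _ => rfl⟩
  smul_mem' c φ h := ⟨contDiff_const.smul h.1, fun x => by simp [h.2 x]⟩

/-- The `C^N` norm of `φ` is at most `M`. -/
def CNBound (N : ℕ) (φ : ℝ → ℂ) (M : ℝ) : Prop :=
  ∀ j ≤ N, ∀ x, ‖iteratedDeriv j φ x‖ ≤ M

/-- `𝒟'(S¹)`: the linear functionals on `C^∞(S¹)` that are continuous for the topology of the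
`C^N` norms, that is, bounded by a multiple of one of these norms. -/
def CircleDistribution : Submodule ℂ (SmoothCircle →ₗ[ℂ] ℂ) where
  carrier := {α | ∃ (N : ℕ) (C : ℝ), ∀ (φ : SmoothCircle) (M : ℝ),
    CNBound N φ M → ‖α φ‖ ≤ C * M}
  add_mem' := by
    rintro α β ⟨N₁, C₁, h₁⟩ ⟨N₂, C₂, h₂⟩
    refine ⟨max N₁ N₂, C₁ + C₂, fun φ M hM => ?_⟩
    have e₁ := h₁ φ M fun j hj => hM j (hj.trans (le_max_left _ _))
    have e₂ := h₂ φ M fun j hj => hM j (hj.trans (le_max_right _ _))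
    calc ‖(α + β) φ‖ ≤ ‖α φ‖ + ‖β φ‖ := norm_add_le _ _
      _ ≤ (C₁ + C₂) * M := by linarith
  zero_mem' := ⟨0, 0, fun φ M _ => by simp⟩
  smul_mem' := by
    rintro c α ⟨N, C, h⟩
    refine ⟨N, ‖c‖ * C, fun φ M hM => ?_⟩
    have e := h φ M hM
    calc ‖(c • α) φ‖ = ‖c‖ * ‖α φ‖ := by simp
      _ ≤ ‖c‖ * (C * M) := by gcongr
      _ = _ := by ring

/-- The Fourier mode `x ↦ e^{2π i n x}`. -/
def fourierMode (n : ℤ) : SmoothCircle :=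
  ⟨fun x => Complex.exp (2 * Real.pi * Complex.I * n * x), by
    refine ⟨?_, fun x => ?_⟩
    · exact (contDiff_const.mul Complex.ofRealCLM.contDiff).cexp
    · rw [Complex.exp_eq_exp_iff_exists_int]
      exact ⟨n, by push_cast; ring⟩⟩

/-- The Fourier coefficient `α̂(n) = ⟨α, e^{-2π i n x}⟩` of a distribution. -/
def fourierCoefficient (α : CircleDistribution) (n : ℤ) : ℂ :=
  (α : SmoothCircle →ₗ[ℂ] ℂ) (fourierMode (-n))

/-- The Japanese bracket `⟨ξ⟩ = (1 + ξ²)^{1/2}`. -/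
def bracket (n : ℤ) : ℝ := Real.sqrt (1 + (n : ℝ) ^ 2)

lemma bracket_pos (n : ℤ) : 0 < bracket n := Real.sqrt_pos.2 (by positivity)

/-- The sequence `⟨n⟩^m α̂(n)`, as a linear function of the distribution `α`. -/
def weightedCoeff (m : ℝ) : CircleDistribution →ₗ[ℂ] (ℤ → ℂ) where
  toFun α := fun n => ((bracket n ^ m : ℝ) : ℂ) * fourierCoefficient α n
  map_add' α β := by
    funext n; simp [fourierCoefficient, mul_add]
  map_smul' c α := by
    funext n; simp [fourierCoefficient]; ring

lemma memlp_two_iff (u : ℤ → ℂ) :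
    Memℓp (E := fun _ : ℤ => ℂ) u 2 ↔ Summable fun n => ‖u n‖ ^ 2 := by
  rw [memℓp_gen_iff (by norm_num)]; norm_num

/-- The Sobolev space `H^m(S¹)`: the distributions `α` with `∑ |⟨n⟩^m α̂(n)|² < ∞`. -/
def SobolevSpace (m : ℝ) : Submodule ℂ CircleDistribution where
  carrier := {α | Summable fun n : ℤ => ‖weightedCoeff m α n‖ ^ 2}
  add_mem' {α β} hα hβ := by
    have hα := (memlp_two_iff _).2 hα
    have hβ := (memlp_two_iff _).2 hβ
    change Summable _
    rw [← memlp_two_iff, map_add]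
    exact hα.add hβ
  zero_mem' := by
    change Summable _
    simp [summable_zero]
  smul_mem' c α hα := by
    have hα := (memlp_two_iff _).2 hα
    change Summable _
    rw [← memlp_two_iff, map_smul]
    exact hα.const_smul c

/-- The embedding `α ↦ (⟨n⟩^m α̂(n))ₙ` of `H^m(S¹)` into `ℓ²(ℤ)`, which defines the norm. -/
def toEll2 (m : ℝ) : SobolevSpace m →ₗ[ℂ] lp (fun _ : ℤ => ℂ) 2 where
  toFun α := ⟨weightedCoeff m α, (memlp_two_iff _).2 α.2⟩
  map_add' α β := by
    apply Subtype.ext; exact map_add (weightedCoeff m) (α : CircleDistribution) β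
  map_smul' c α := by
    apply Subtype.ext; exact map_smul (weightedCoeff m) c (α : CircleDistribution)

/-! A distribution is determined by its Fourier coefficients, so the above map is injective. -/

lemma periodic_deriv {f : ℝ → ℂ} {c : ℝ} (h : Function.Periodic f c) :
    Function.Periodic (deriv f) c := fun x => by
  have : deriv (fun y => f (y + c)) x = deriv f (x + c) := deriv_comp_add_const _ _ _
  rw [← this, h.funext]

lemma deriv_mem {φ : ℝ → ℂ} (h : φ ∈ SmoothCircle) : deriv φ ∈ SmoothCircle :=
  ⟨(contDiff_infty_iff_deriv.1 h.1).2, periodic_deriv h.2⟩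

lemma iteratedDeriv_mem {φ : ℝ → ℂ} (h : φ ∈ SmoothCircle) (j : ℕ) :
    iteratedDeriv j φ ∈ SmoothCircle := by
  induction j with
  | zero => simpa using h
  | succ j ih => rw [iteratedDeriv_succ]; exact deriv_mem ih

/-- A smooth periodic function as a continuous function on `AddCircle 1`. -/
def toCircle (φ : SmoothCircle) : C(AddCircle (1 : ℝ), ℂ) :=
  ⟨φ.2.2.lift, continuous_coinduced_dom.2 φ.2.1.continuous⟩

lemma toCircle_coe (φ : SmoothCircle) (x : ℝ) : toCircle φ (x : AddCircle (1 : ℝ)) = φ.1 x := rfl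

lemma fourierCoeff_toCircle (φ : SmoothCircle) (n : ℤ) :
    fourierCoeff (toCircle φ) n =
      ∫ x in (0 : ℝ)..1, (fourierMode (-n)).1 x * φ.1 x := by
  rw [fourierCoeff_eq_intervalIntegral _ n 0]
  simp only [toCircle_coe, fourier_coe_apply, fourierMode]
  simp

lemma fourierMode_hasDerivAt (n : ℤ) (x : ℝ) :
    HasDerivAt (fourierMode n).1
      ((2 * Real.pi * Complex.I * n) * (fourierMode n).1 x) x := by
  have h : HasDerivAt (fun x : ℝ => 2 * Real.pi * Complex.I * n * (x : ℂ))
      (2 * Real.pi * Complex.I * n * 1) x :=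
    (Complex.ofRealCLM.hasDerivAt (x := x)).const_mul _
  have := h.cexp
  simpa [fourierMode, mul_comm] using this

lemma fourierCoeff_deriv (φ : SmoothCircle) (n : ℤ) :
    fourierCoeff (toCircle ⟨deriv φ.1, deriv_mem φ.2⟩) n =
      (2 * Real.pi * Complex.I * n) * fourierCoeff (toCircle φ) n := by
  rw [fourierCoeff_toCircle, fourierCoeff_toCircle]
  have h := intervalIntegral.integral_mul_deriv_eq_deriv_mul (a := 0) (b := 1)
    (u := (fourierMode (-n)).1) (v := φ.1)
    (u' := fun x => (2 * Real.pi * Complex.I * ((-n : ℤ) : ℂ)) * (fourierMode (-n)).1 x)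
    (v' := deriv φ.1)
    (fun x _ => fourierMode_hasDerivAt _ _)
    (fun x _ => (φ.2.1.differentiable (by simp) x).hasDerivAt)
    ((continuous_const.mul (fourierMode (-n)).2.1.continuous).intervalIntegrable _ _)
    ((deriv_mem φ.2).1.continuous.intervalIntegrable _ _)
  have e1 : (fourierMode (-n)).1 1 = (fourierMode (-n)).1 0 := by
    simpa using (fourierMode (-n)).2.2 0
  have e2 : φ.1 1 = φ.1 0 := by simpa using φ.2.2 0
  rw [h, e1, e2, sub_self, zero_sub, ← intervalIntegral.integral_const_mul,
    ← intervalIntegral.integral_neg]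
  congr 1
  funext x
  push_cast
  ring

lemma fourierCoeff_iteratedDeriv (φ : SmoothCircle) (j : ℕ) (n : ℤ) :
    fourierCoeff (toCircle ⟨iteratedDeriv j φ.1, iteratedDeriv_mem φ.2 j⟩) n =
      (2 * Real.pi * Complex.I * n) ^ j * fourierCoeff (toCircle φ) n := by
  induction j with
  | zero => simp
  | succ j ih =>
    have h := fourierCoeff_deriv ⟨iteratedDeriv j φ.1, iteratedDeriv_mem φ.2 j⟩ n
    rw [ih] at h
    simp only [iteratedDeriv_succ]
    rw [h]; ring

lemma norm_fourierCoeff_le (φ : SmoothCircle) (n : ℤ) :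
    ‖fourierCoeff (toCircle φ) n‖ ≤ ‖toCircle φ‖ := by
  rw [fourierCoeff]
  refine (norm_integral_le_of_norm_le_const (C := ‖toCircle φ‖) ?_).trans ?_
  · refine Filter.Eventually.of_forall fun x => ?_
    rw [norm_smul]
    have : ‖fourier (-n) x‖ = 1 := Circle.norm_coe _
    rw [this, one_mul]
    exact (toCircle φ).norm_coe_le_norm x
  · simp

lemma summable_fourierCoeff (φ : SmoothCircle) : Summable (fourierCoeff (toCircle φ)) := by
  set M := ‖toCircle ⟨iteratedDeriv 2 φ.1, iteratedDeriv_mem φ.2 2⟩‖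
  have hs : Summable fun n : ℤ => M * (1 / (n : ℝ) ^ 2) :=
    (Real.summable_one_div_int_pow.2 one_lt_two).mul_left M
  refine hs.of_norm_bounded_eventually ?_
  have : ({0} : Set ℤ)ᶜ ∈ Filter.cofinite := (Set.finite_singleton 0).compl_mem_cofinite
  filter_upwards [this] with n hn
  have hn : (n : ℝ) ≠ 0 := by simpa using hn
  have h := norm_fourierCoeff_le ⟨iteratedDeriv 2 φ.1, iteratedDeriv_mem φ.2 2⟩ n
  rw [fourierCoeff_iteratedDeriv, norm_mul] at h
  have h2 : (n : ℝ) ^ 2 ≤ ‖(2 * Real.pi * Complex.I * n : ℂ) ^ 2‖ := by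
    rw [norm_pow]
    have : ‖(2 * Real.pi * Complex.I * n : ℂ)‖ = 2 * Real.pi * |(n : ℝ)| := by
      simp [abs_of_pos Real.pi_pos]
    rw [this, ← sq_abs (n : ℝ)]
    gcongr
    have := Real.pi_gt_three
    nlinarith [abs_nonneg (n : ℝ)]
  rw [mul_one_div, le_div_iff₀ (by positivity), mul_comm]
  exact (mul_le_mul_of_nonneg_right h2 (norm_nonneg _)).trans h

lemma iteratedDeriv_fourierMode (n : ℤ) (j : ℕ) :
    iteratedDeriv j (fourierMode n).1 =
      fun x => (2 * Real.pi * Complex.I * n) ^ j * (fourierMode n).1 x := by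
  induction j with
  | zero => simp
  | succ j ih =>
    rw [iteratedDeriv_succ, ih]
    funext x
    rw [((fourierMode_hasDerivAt n x).const_mul _).deriv]
    ring

lemma fourier_eq_fourierMode (n : ℤ) (x : ℝ) :
    fourier n (x : AddCircle (1 : ℝ)) = (fourierMode n).1 x := by
  simp [fourierMode]

/-- The partial sums of the Fourier series of `φ`. -/
def fourierPartialSum (φ : SmoothCircle) (s : Finset ℤ) : SmoothCircle :=
  ∑ n ∈ s, fourierCoeff (toCircle φ) n • fourierMode n

lemma iteratedDeriv_fourierPartialSum (φ : SmoothCircle) (s : Finset ℤ) (j : ℕ) (x : ℝ) :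
    iteratedDeriv j (fourierPartialSum φ s).1 x =
      ∑ n ∈ s, fourierCoeff (toCircle ⟨iteratedDeriv j φ.1, iteratedDeriv_mem φ.2 j⟩) n •
        fourier n (x : AddCircle (1 : ℝ)) := by
  have e : (fourierPartialSum φ s).1 =
      fun y => ∑ n ∈ s, fourierCoeff (toCircle φ) n * (fourierMode n).1 y := by
    funext y
    simp [fourierPartialSum]
  rw [e, iteratedDeriv_fun_sum fun n _ =>
    (contDiff_const.mul (fourierMode n).2.1).contDiffAt.of_le (by exact_mod_cast le_top)]
  refine Finset.sum_congr rfl fun n _ => ?_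
  rw [iteratedDeriv_const_mul_field, iteratedDeriv_fourierMode, fourierCoeff_iteratedDeriv,
    fourier_eq_fourierMode, smul_eq_mul]
  ring

lemma eventually_CNBound (φ : SmoothCircle) (N : ℕ) {ε : ℝ} (hε : 0 < ε) :
    ∀ᶠ s : Finset ℤ in Filter.atTop, CNBound N (φ - fourierPartialSum φ s).1 ε := by
  have h : ∀ j ∈ Finset.range (N + 1), ∀ᶠ s : Finset ℤ in Filter.atTop,
      ∀ x, ‖iteratedDeriv j (φ - fourierPartialSum φ s).1 x‖ ≤ ε := by
    intro j _
    have hs := hasSum_fourier_series_of_summable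
      (summable_fourierCoeff ⟨iteratedDeriv j φ.1, iteratedDeriv_mem φ.2 j⟩)
    filter_upwards [(Metric.tendsto_nhds.1 hs) ε hε] with s hs x
    rw [dist_eq_norm, norm_sub_rev] at hs
    have h1 := ((ContinuousMap.norm_coe_le_norm _ (x : AddCircle (1 : ℝ))).trans hs.le)
    have h2 : (φ - fourierPartialSum φ s).1 = φ.1 - (fourierPartialSum φ s).1 := rfl
    rw [h2, iteratedDeriv_sub (φ.2.1.contDiffAt.of_le (by exact_mod_cast le_top))
      ((fourierPartialSum φ s).2.1.contDiffAt.of_le (by exact_mod_cast le_top)),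
      iteratedDeriv_fourierPartialSum]
    simpa [toCircle_coe] using h1
  filter_upwards [(Filter.eventually_all_finset _).2 h] with s hs j hj x
  exact hs j (Finset.mem_range.2 (Nat.lt_succ_of_le hj)) x

lemma eq_zero_of_fourierCoefficient {α : CircleDistribution}
    (h : ∀ n, fourierCoefficient α n = 0) : α = 0 := by
  obtain ⟨N, C, hC⟩ := α.2
  apply Subtype.ext
  apply LinearMap.ext
  intro φ
  change α.1 φ = 0
  have h0 : ∀ s, α.1 (fourierPartialSum φ s) = 0 := fun s => by
    rw [fourierPartialSum, map_sum]
    refine Finset.sum_eq_zero fun n _ => ?_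
    have := h (-n)
    rw [fourierCoefficient, neg_neg] at this
    rw [map_smul, this, smul_zero]
  have h1 : ∀ ε > 0, ‖α.1 φ‖ ≤ C * ε := fun ε hε => by
    obtain ⟨s, hs⟩ := (eventually_CNBound φ N hε).exists
    have := hC _ _ hs
    rwa [map_sub, h0, sub_zero] at this
  by_contra hne
  have hp : 0 < ‖α.1 φ‖ := norm_pos_iff.2 hne
  have h2 := h1 (‖α.1 φ‖ / (2 * (|C| + 1))) (by positivity)
  have h3 : C * (‖α.1 φ‖ / (2 * (|C| + 1))) ≤ ‖α.1 φ‖ / 2 := by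
    rw [mul_div_assoc', div_le_div_iff₀ (by positivity) two_pos]
    nlinarith [le_abs_self C]
  linarith

lemma toEll2_injective (m : ℝ) : Function.Injective (toEll2 m) := by
  intro α β h
  apply Subtype.ext
  rw [← sub_eq_zero]
  refine eq_zero_of_fourierCoefficient fun n => ?_
  have h1 : weightedCoeff m α n = weightedCoeff m β n :=
    congrArg (fun u : lp (fun _ : ℤ => ℂ) 2 => u n) h
  have h2 : ((bracket n ^ m : ℝ) : ℂ) ≠ 0 := by
    exact_mod_cast (Real.rpow_pos_of_pos (bracket_pos n) m).ne'
  exact sub_eq_zero.2 (mul_left_cancel₀ h2 h1)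

/-- `H^m(S¹)` with the norm `‖α‖ = (∑ |⟨n⟩^m α̂(n)|²)^{1/2}`. -/
instance (m : ℝ) : NormedAddCommGroup (SobolevSpace m) :=
  NormedAddCommGroup.induced _ _ (toEll2 m) (toEll2_injective m)

instance (m : ℝ) : NormedSpace ℂ (SobolevSpace m) :=
  NormedSpace.induced ℂ (SobolevSpace m) (lp (fun _ : ℤ => ℂ) 2) (toEll2 m)

lemma sobolev_norm_sq (m : ℝ) (α : SobolevSpace m) :
    ‖α‖ ^ 2 = ∑' n : ℤ, (bracket n ^ m * ‖fourierCoefficient α n‖) ^ 2 := by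
  have h := lp.norm_rpow_eq_tsum (p := 2) (by norm_num) (toEll2 m α)
  have e : ∀ n, ‖toEll2 m α n‖ = bracket n ^ m * ‖fourierCoefficient α n‖ := fun n => by
    change ‖((bracket n ^ m : ℝ) : ℂ) * _‖ = _
    rw [norm_mul, Complex.norm_real, Real.norm_of_nonneg
      (Real.rpow_nonneg (bracket_pos n).le m)]
  simp only [e] at h
  have h' : ‖toEll2 m α‖ ^ 2 = ∑' n : ℤ, (bracket n ^ m * ‖fourierCoefficient α n‖) ^ 2 := by
    simpa using h
  exact h'

/-! ### The expanding map and the transfer operator -/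

/-- The data `(k, g, τ)`: an integer `k ≥ 2`, (a lift to `ℝ` of) an orientation preserving smooth
diffeomorphism `g` of `S¹` such that `E = k g mod 1` is uniformly expanding, and a smooth function
`τ : S¹ → ℝ`. -/
structure ExpandingData where
  k : ℕ
  two_le_k : 2 ≤ k
  g : ℝ ≃ₘ[ℝ] ℝ
  g_add_one : ∀ x, g (x + 1) = g x + 1
  τ : ℝ → ℝ
  τ_smooth : ContDiff ℝ ∞ τ
  τ_periodic : Function.Periodic τ 1
  one_lt_Emin : 1 < ⨅ x : ℝ, deriv (fun y => (k : ℝ) * g y) x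

namespace ExpandingData

variable (S : ExpandingData)

/-- The lift `E(x) = k g(x)` of the expanding map of the circle. -/
def E (x : ℝ) : ℝ := S.k * S.g x

/-- The minimum `E_min` of the derivative of `E`. -/
def Emin : ℝ := ⨅ x : ℝ, deriv S.E x

lemma contDiff_g : ContDiff ℝ ∞ S.g := S.g.contDiff

lemma contDiff_gsymm : ContDiff ℝ ∞ S.g.symm := S.g.symm.contDiff

lemma contDiff_E : ContDiff ℝ ∞ S.E := contDiff_const.mul S.contDiff_g

lemma k_pos : (0 : ℝ) < S.k := by
  have := S.two_le_k
  exact_mod_cast (by omega : 0 < S.k)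

lemma Emin_le (x : ℝ) : S.Emin ≤ deriv S.E x := by
  refine ciInf_le ?_ x
  by_contra hb
  have h := S.one_lt_Emin
  have h0 : (⨅ x : ℝ, deriv (fun y => (S.k : ℝ) * S.g y) x) = 0 := Real.iInf_of_not_bddBelow hb
  rw [h0] at h
  linarith

lemma deriv_E_pos (x : ℝ) : 0 < deriv S.E x :=
  zero_lt_one.trans (S.one_lt_Emin.trans_le (S.Emin_le x))

lemma E_add_one (x : ℝ) : S.E (x + 1) = S.E x + S.k := by
  simp [E, S.g_add_one, mul_add]

lemma periodic_deriv_E : Function.Periodic (deriv S.E) 1 := fun x => by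
  have h : deriv (fun y => S.E (y + 1)) x = deriv S.E (x + 1) := deriv_comp_add_const _ _ _
  rw [← h, show (fun y => S.E (y + 1)) = fun y => S.E y + S.k from funext S.E_add_one]
  simp

lemma gsymm_add_one (x : ℝ) : S.g.symm (x + 1) = S.g.symm x + 1 := by
  apply S.g.injective
  change S.g (S.g.symm (x + 1)) = S.g (S.g.symm x + 1)
  rw [S.g_add_one]
  simp

lemma gsymm_add_nat (x : ℝ) (n : ℕ) : S.g.symm (x + n) = S.g.symm x + n := by
  induction n with
  | zero => simp
  | succ n ih => push_cast; rw [← add_assoc, gsymm_add_one, ih, add_assoc]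

/-- The inverse branch `x_ε = g⁻¹((y + ε) / k)`; for `ε = 0, …, k - 1` these are the `k` preimages
of `y` under `E` modulo `1`. -/
def branch (ε : ℕ) (y : ℝ) : ℝ := S.g.symm ((y + ε) / S.k)

lemma E_branch (ε : ℕ) (y : ℝ) : S.E (S.branch ε y) = y + ε := by
  have := S.k_pos.ne'
  simp [E, branch]
  field_simp

lemma contDiff_branch (ε : ℕ) : ContDiff ℝ ∞ (S.branch ε) :=
  S.contDiff_gsymm.comp ((contDiff_id.add contDiff_const).div_const _)

lemma branch_add_one (ε : ℕ) (y : ℝ) : S.branch ε (y + 1) = S.branch (ε + 1) y := by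
  simp only [branch]; push_cast; congr 2; ring

lemma branch_add_k (ε : ℕ) (y : ℝ) : S.branch ε (y + S.k) = S.branch ε y + 1 := by
  have := S.k_pos.ne'
  simp only [branch]
  rw [← S.gsymm_add_one]; congr 1; field_simp; ring

/-- The unimodular weight `e^{iντ(x)}`. -/
def weight (ν : ℝ) (x : ℝ) : ℂ := Complex.exp (Complex.I * ν * S.τ x)

lemma contDiff_weight (ν : ℝ) : ContDiff ℝ ∞ (S.weight ν) :=
  (contDiff_const.mul (Complex.ofRealCLM.contDiff.comp S.τ_smooth)).cexp

lemma periodic_weight (ν : ℝ) : Function.Periodic (S.weight ν) 1 := fun x => by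
  simp [weight, S.τ_periodic x]

/-- The transfer operator on smooth functions: `φ ↦ e^{iντ} · (φ ∘ E)`. -/
def transferSmooth (ν : ℝ) (φ : SmoothCircle) : SmoothCircle :=
  ⟨fun x => S.weight ν x * φ.1 (S.E x), (S.contDiff_weight ν).mul (φ.2.1.comp S.contDiff_E),
    fun x => by
      have h : φ.1 (S.E x + S.k) = φ.1 (S.E x) := by simpa using φ.2.2.nat_mul S.k (S.E x)
      change S.weight ν (x + 1) * φ.1 (S.E (x + 1)) = S.weight ν x * φ.1 (S.E x)
      rw [S.periodic_weight, S.E_add_one, h]⟩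

/-- The Jacobian weight `e^{iντ(x)} / E'(x)`. -/
def jacWeight (ν : ℝ) (x : ℝ) : ℂ := S.weight ν x / (deriv S.E x : ℝ)

lemma contDiff_jacWeight (ν : ℝ) : ContDiff ℝ ∞ (S.jacWeight ν) := by
  have h : ContDiff ℝ ∞ fun x => ((deriv S.E x : ℝ) : ℂ) :=
    Complex.ofRealCLM.contDiff.comp (contDiff_infty_iff_deriv.1 S.contDiff_E).2
  have h' : ContDiff ℝ ∞ fun x => ((deriv S.E x : ℝ) : ℂ)⁻¹ :=
    h.inv fun x => by simpa using (S.deriv_E_pos x).ne'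
  exact (S.contDiff_weight ν).mul h'

lemma periodic_jacWeight (ν : ℝ) : Function.Periodic (S.jacWeight ν) 1 := fun x => by
  simp [jacWeight, S.periodic_weight ν x, S.periodic_deriv_E x]

lemma branch_term_shift (ν : ℝ) (φ : SmoothCircle) (y : ℝ) :
    ∑ ε ∈ Finset.range S.k, S.jacWeight ν (S.branch ε (y + 1)) * φ.1 (S.branch ε (y + 1)) =
      ∑ ε ∈ Finset.range S.k, S.jacWeight ν (S.branch ε y) * φ.1 (S.branch ε y) := by
  simp only [branch_add_one]
  set G : ℕ → ℂ := fun ε => S.jacWeight ν (S.branch ε y) * φ.1 (S.branch ε y)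
  have h1 := Finset.sum_range_succ G S.k
  have h2 := Finset.sum_range_succ' G S.k
  have h3 : G S.k = G 0 := by
    have : S.branch S.k y = S.branch 0 y + 1 := by
      rw [← S.branch_add_k]; simp [branch]
    simp only [G]
    rw [this, S.periodic_jacWeight, φ.2.2]
  rw [h1, h3] at h2
  exact (add_right_cancel h2).symm

/-- The transpose of the transfer operator on smooth functions for the bilinear pairing
`∫ φ ψ`: `(Fᵗ φ)(y) = ∑_{x ∈ E⁻¹(y)} e^{iντ(x)} / E'(x) φ(x)`. It is the `L²`-adjoint conjugated by
complex conjugation. -/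
def transpose (ν : ℝ) : SmoothCircle →ₗ[ℂ] SmoothCircle where
  toFun φ := ⟨fun y => ∑ ε ∈ Finset.range S.k,
      S.jacWeight ν (S.branch ε y) * φ.1 (S.branch ε y),
    ContDiff.sum fun ε _ => ((S.contDiff_jacWeight ν).comp (S.contDiff_branch ε)).mul
      (φ.2.1.comp (S.contDiff_branch ε)),
    S.branch_term_shift ν φ⟩
  map_add' φ ψ := by
    apply Subtype.ext; funext y
    simp [mul_add, Finset.sum_add_distrib]
  map_smul' c φ := by
    apply Subtype.ext; funext y
    simp only [Submodule.coe_smul, Pi.smul_apply, smul_eq_mul, RingHom.id_apply, Finset.mul_sum]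
    exact Finset.sum_congr rfl fun ε _ => by ring

/-! The transpose is continuous for the `C^N` norms. -/

lemma bounded_of_periodic {F : Type*} [NormedAddCommGroup F] {f : ℝ → F} {c : ℝ} (hc : c ≠ 0)
    (hf : Continuous f) (hp : Function.Periodic f c) : ∃ B : ℝ, 1 ≤ B ∧ ∀ x, ‖f x‖ ≤ B := by
  obtain ⟨B, hB⟩ := isBounded_iff_forall_norm_le.1 (hp.isBounded_of_continuous hc hf)
  exact ⟨max B 1, le_max_right _ _, fun x => (hB _ ⟨x, rfl⟩).trans (le_max_left _ _)⟩

lemma periodic_iteratedDeriv {F : Type*} [NormedAddCommGroup F] [NormedSpace ℝ F] {f : ℝ → F}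
    {c : ℝ} (hp : Function.Periodic f c) (j : ℕ) :
    Function.Periodic (iteratedDeriv j f) c := fun x => by
  have h : iteratedDeriv j (fun y => f (y + c)) x = iteratedDeriv j f (x + c) := by
    rw [iteratedDeriv_comp_add_const]
  rw [← h, hp.funext]

lemma uniform_bound {F : Type*} [NormedAddCommGroup F] [NormedSpace ℝ F] {f : ℝ → F} {c : ℝ}
    (hc : c ≠ 0) (hf : ContDiff ℝ ∞ f) (hp : Function.Periodic f c) (N : ℕ) :
    ∃ B : ℝ, 1 ≤ B ∧ ∀ j ≤ N, ∀ x, ‖iteratedDeriv j f x‖ ≤ B := by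
  have h : ∀ j, ∃ B : ℝ, 1 ≤ B ∧ ∀ x, ‖iteratedDeriv j f x‖ ≤ B := fun j =>
    bounded_of_periodic hc (hf.continuous_iteratedDeriv j (by exact_mod_cast le_top))
      (periodic_iteratedDeriv hp j)
  choose B hB1 hB using h
  refine ⟨∑ j ∈ Finset.range (N + 1), B j, ?_, fun j hj x => (hB j x).trans ?_⟩
  · exact (hB1 0).trans (Finset.single_le_sum (f := B) (fun i _ => zero_le_one.trans (hB1 i))
      (by simp))
  · exact Finset.single_le_sum (f := B) (fun i _ => zero_le_one.trans (hB1 i))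
      (Finset.mem_range.2 (Nat.lt_succ_of_le hj))

lemma CNBound_branch_term (ν : ℝ) (ε N : ℕ) : ∃ C : ℝ, ∀ (φ : SmoothCircle) (M : ℝ),
    CNBound N φ.1 M →
      CNBound N (fun y => S.jacWeight ν (S.branch ε y) * φ.1 (S.branch ε y)) (C * M) := by
  have hk := S.k_pos.ne'
  have hb := S.contDiff_branch ε
  obtain ⟨A, hA1, hA⟩ := uniform_bound (c := (S.k : ℝ)) hk
    ((S.contDiff_jacWeight ν).comp hb)
    (fun y => by simp [S.branch_add_k, S.periodic_jacWeight ν _]) N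
  obtain ⟨D, hD1, hD⟩ := uniform_bound (f := deriv (S.branch ε)) (c := (S.k : ℝ)) hk
    (contDiff_infty_iff_deriv.1 hb).2 (fun x => by
      have h : deriv (fun y => S.branch ε (y + S.k)) x = deriv (S.branch ε) (x + S.k) :=
        deriv_comp_add_const _ _ _
      rw [← h, show (fun y => S.branch ε (y + S.k)) = fun y => S.branch ε y + 1 from
        funext (S.branch_add_k ε)]
      simp) N
  refine ⟨∑ j ∈ Finset.range (N + 1), ∑ i ∈ Finset.range (j + 1),
    (j.choose i : ℝ) * A * ((j - i).factorial * D ^ (j - i)), fun φ M hM j hj x => ?_⟩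
  have hM0 : 0 ≤ M := (norm_nonneg _).trans (hM 0 (Nat.zero_le _) 0)
  have hD0 : 0 ≤ D := zero_le_one.trans hD1
  have hcomp : ∀ n ≤ N, ‖iteratedFDeriv ℝ n (φ.1 ∘ S.branch ε) x‖ ≤
      n.factorial * M * D ^ n := fun n hn => by
    refine norm_iteratedFDeriv_comp_le φ.2.1 hb (by exact_mod_cast le_top) x ?_ ?_
    · intro i hi
      rw [norm_iteratedFDeriv_eq_norm_iteratedDeriv]
      exact hM i (hi.trans hn) _
    · intro i hi1 hi
      rw [norm_iteratedFDeriv_eq_norm_iteratedDeriv]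
      obtain ⟨i, rfl⟩ : ∃ l, i = l + 1 := ⟨i - 1, by omega⟩
      rw [iteratedDeriv_succ']
      exact (hD i (by omega) x).trans (le_self_pow₀ hD1 (by omega))
  rw [← norm_iteratedFDeriv_eq_norm_iteratedDeriv]
  refine (norm_iteratedFDeriv_mul_le ((S.contDiff_jacWeight ν).comp hb) (φ.2.1.comp hb) x
    (n := j) (by exact_mod_cast le_top)).trans ?_
  calc _ ≤ ∑ i ∈ Finset.range (j + 1),
        (j.choose i : ℝ) * A * ((j - i).factorial * M * D ^ (j - i)) := by
        refine Finset.sum_le_sum fun i hi => ?_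
        have hi := Finset.mem_range.1 hi
        gcongr
        · rw [norm_iteratedFDeriv_eq_norm_iteratedDeriv]
          exact hA i (by omega) x
        · exact hcomp (j - i) (by omega)
    _ = (∑ i ∈ Finset.range (j + 1),
        (j.choose i : ℝ) * A * ((j - i).factorial * D ^ (j - i))) * M := by
        rw [Finset.sum_mul]
        exact Finset.sum_congr rfl fun i _ => by ring
    _ ≤ _ := by
        gcongr
        refine Finset.single_le_sum (f := fun j => ∑ i ∈ Finset.range (j + 1),
          (j.choose i : ℝ) * A * ((j - i).factorial * D ^ (j - i))) (fun i _ => ?_)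
          (Finset.mem_range.2 (Nat.lt_succ_of_le hj))
        positivity

lemma CNBound_transpose (ν : ℝ) (N : ℕ) : ∃ C : ℝ, ∀ (φ : SmoothCircle) (M : ℝ),
    CNBound N φ.1 M → CNBound N (S.transpose ν φ).1 (C * M) := by
  choose C hC using fun ε => S.CNBound_branch_term ν ε N
  refine ⟨∑ ε ∈ Finset.range S.k, C ε, fun φ M hM j hj x => ?_⟩
  have e : (S.transpose ν φ).1 = fun y => ∑ ε ∈ Finset.range S.k,
      S.jacWeight ν (S.branch ε y) * φ.1 (S.branch ε y) := rfl
  have hs : ∀ ε ∈ Finset.range S.k, ContDiffAt ℝ j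
      (fun y => S.jacWeight ν (S.branch ε y) * φ.1 (S.branch ε y)) x := fun ε _ =>
    (((S.contDiff_jacWeight ν).comp (S.contDiff_branch ε)).mul
      (φ.2.1.comp (S.contDiff_branch ε))).contDiffAt.of_le (by exact_mod_cast le_top)
  rw [e, iteratedDeriv_fun_sum hs, Finset.sum_mul]
  exact norm_sum_le_of_le _ fun ε _ => hC ε φ M hM j hj x

/-- The transfer operator `F_ν` on `𝒟'(S¹)`, by duality: `⟨F_ν α, φ⟩ = ⟨α, Fᵗ φ⟩`. -/
def transfer (ν : ℝ) : CircleDistribution →ₗ[ℂ] CircleDistribution where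
  toFun α := ⟨α.1 ∘ₗ S.transpose ν, by
    obtain ⟨N, C, hC⟩ := α.2
    obtain ⟨C', hC'⟩ := S.CNBound_transpose ν N
    exact ⟨N, C * C', fun φ M hM => by
      rw [mul_assoc]; exact hC _ _ (hC' φ M hM)⟩⟩
  map_add' _ _ := rfl
  map_smul' _ _ := rfl

end ExpandingData

/-- The distribution `φ ↦ ∫ ψ φ` given by a smooth function `ψ`. -/
def ofSmooth (ψ : SmoothCircle) : CircleDistribution :=
  ⟨{ toFun := fun φ => ∫ x in (0 : ℝ)..1, ψ.1 x * φ.1 x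
     map_add' := fun φ₁ φ₂ => by
       have h := intervalIntegral.integral_add
         ((ψ.2.1.continuous.mul φ₁.2.1.continuous).intervalIntegrable (μ := volume) 0 1)
         ((ψ.2.1.continuous.mul φ₂.2.1.continuous).intervalIntegrable (μ := volume) 0 1)
       simp only [Pi.mul_apply] at h
       rw [← h]
       simp [mul_add]
     map_smul' := fun c φ => by
       simp only [RingHom.id_apply, smul_eq_mul]
       rw [← intervalIntegral.integral_const_mul]
       congr 1; funext x
       simp only [Submodule.coe_smul, Pi.smul_apply, smul_eq_mul]; ring },
   by
    obtain ⟨B, hB1, hB⟩ := ExpandingData.bounded_of_periodic one_ne_zero ψ.2.1.continuous ψ.2.2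
    refine ⟨0, B, fun φ M hM => ?_⟩
    have h : ∀ x ∈ Set.uIoc (0 : ℝ) 1, ‖ψ.1 x * φ.1 x‖ ≤ B * M := fun x _ => by
      rw [norm_mul]
      have := hM 0 le_rfl x
      rw [iteratedDeriv_zero] at this
      exact mul_le_mul (hB x) this (norm_nonneg _) (zero_le_one.trans hB1)
    simpa using intervalIntegral.norm_integral_le_of_norm_le_const h⟩

/-- On smooth functions, the operator on distributions is `φ ↦ e^{iντ} · (φ ∘ E)`. -/
lemma ExpandingData.transfer_ofSmooth (S : ExpandingData) (ν : ℝ) (ψ : SmoothCircle) :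
    S.transfer ν (ofSmooth ψ) = ofSmooth (S.transferSmooth ν ψ) := by
  apply Subtype.ext
  apply LinearMap.ext
  intro φ
  change ∫ y in (0 : ℝ)..1, ψ.1 y * (∑ ε ∈ Finset.range S.k,
      S.jacWeight ν (S.branch ε y) * φ.1 (S.branch ε y)) =
    ∫ x in (0 : ℝ)..1, (S.weight ν x * ψ.1 (S.E x)) * φ.1 x
  set G : ℝ → ℂ := fun x => (S.weight ν x * ψ.1 (S.E x)) * φ.1 x with hG
  set H : ℝ → ℂ := fun x => ψ.1 (S.E x) * (S.jacWeight ν x * φ.1 x) with hH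
  have hHc : Continuous H := (ψ.2.1.continuous.comp S.contDiff_E.continuous).mul
    ((S.contDiff_jacWeight ν).continuous.mul φ.2.1.continuous)
  have hbc : Continuous (S.branch 0) := (S.contDiff_branch 0).continuous
  have hGp : Function.Periodic G 1 := ((S.transferSmooth ν ψ).2.2).mul φ.2.2
  -- the sum over the branches is one integral over `[0, k]`
  have h1 : ∫ y in (0 : ℝ)..1, ψ.1 y * (∑ ε ∈ Finset.range S.k,
      S.jacWeight ν (S.branch ε y) * φ.1 (S.branch ε y)) =
      ∫ z in (0 : ℝ)..S.k, H (S.branch 0 z) := by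
    have h2 : ∀ ε : ℕ, ∀ y, ψ.1 y * (S.jacWeight ν (S.branch ε y) * φ.1 (S.branch ε y)) =
        H (S.branch 0 (y + ε)) := fun ε y => by
      have e1 : S.branch 0 (y + ε) = S.branch ε y := by simp [branch]
      have e2 : ψ.1 (y + ε) = ψ.1 y := by simpa using ψ.2.2.nat_mul ε y
      simp only [hH]
      rw [e1, S.E_branch, e2]
    simp only [Finset.mul_sum, h2]
    have hi : ∀ ε ∈ Finset.range S.k, IntervalIntegrable
        (fun y : ℝ => H (S.branch 0 (y + (ε : ℝ)))) volume 0 1 := fun ε _ =>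
      (hHc.comp (hbc.comp (continuous_id.add continuous_const))).intervalIntegrable _ _
    rw [intervalIntegral.integral_finsetSum hi]
    have h3 := intervalIntegral.sum_integral_adjacent_intervals (a := fun n : ℕ => (n : ℝ))
      (f := fun z => H (S.branch 0 z)) (μ := volume) (n := S.k)
      fun n _ => (hHc.comp hbc).intervalIntegrable _ _
    rw [Nat.cast_zero] at h3
    rw [← h3]
    refine Finset.sum_congr rfl fun ε _ => ?_
    rw [intervalIntegral.integral_comp_add_right (fun z => H (S.branch 0 z))]
    congr 1 <;> push_cast <;> ring
  -- change of variables `z = E x`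
  have h4 : ∫ z in S.E (S.branch 0 0)..S.E (S.branch 0 0 + 1), H (S.branch 0 z) =
      ∫ x in (S.branch 0 0)..(S.branch 0 0 + 1), G x := by
    rw [← intervalIntegral.integral_deriv_smul_comp (f := S.E) (f' := deriv S.E)
      (g := fun z => H (S.branch 0 z))
      (fun x _ => (S.contDiff_E.differentiable (by simp) x).hasDerivAt)
      (contDiff_infty_iff_deriv.1 S.contDiff_E).2.continuous.continuousOn (hHc.comp hbc)]
    congr 1
    funext x
    have e1 : S.branch 0 (S.E x) = x := by
      simp [branch, E, S.k_pos.ne']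
    have e2 : ((deriv S.E x : ℝ) : ℂ) ≠ 0 := by exact_mod_cast (S.deriv_E_pos x).ne'
    simp only [Function.comp, e1, hH, hG, jacWeight, Complex.real_smul]
    field_simp
  rw [S.E_add_one, S.E_branch] at h4
  simp only [Nat.cast_zero, add_zero, zero_add] at h4
  rw [h1, h4, hGp.intervalIntegral_add_eq _ 0, zero_add]

/-! ### Spectral notions -/

section Spectral

variable {X : Type*} [NormedAddCommGroup X] [NormedSpace ℂ X]

/-- The essential spectrum: the `z` for which `T - z` is not a Fredholm operator. -/
def essentialSpectrum (T : X →L[ℂ] X) : Set ℂ :=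
  {z | ¬ (T - z • ContinuousLinearMap.id ℂ X).IsFredholm}

/-- The essential spectral radius. -/
def essentialSpectralRadius (T : X →L[ℂ] X) : ℝ≥0∞ :=
  ⨆ z ∈ essentialSpectrum T, (‖z‖₊ : ℝ≥0∞)

/-- The generalized eigenspace `⋃ₙ ker (T - z)ⁿ`. -/
def genEigenspace (T : X →L[ℂ] X) (z : ℂ) : Submodule ℂ X :=
  Module.End.maxGenEigenspace (T : X →ₗ[ℂ] X) z

/-- `z` is a discrete eigenvalue: an isolated point of the spectrum which is an eigenvalue of
finite algebraic multiplicity. -/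
def IsDiscreteEigenvalue (T : X →L[ℂ] X) (z : ℂ) : Prop :=
  Module.End.HasEigenvalue (T : X →ₗ[ℂ] X) z ∧
  FiniteDimensional ℂ (genEigenspace T z) ∧
  ∃ ε > 0, ∀ w ∈ spectrum ℂ T, ‖w - z‖ < ε → w = z

end Spectral

/-- `r_m = E_min^{-|m|} √(k / E_min)`. -/
def ExpandingData.rm (S : ExpandingData) (m : ℝ) : ℝ :=
  1 / S.Emin ^ |m| * Real.sqrt (S.k / S.Emin)

end Ruelle
end

noncomputable section

namespace Ruelle

/-! ### Operators of essential norm at most `r` -/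

/-! Everything is proved on the dual side, where the transpose `L` averages over the inverse
branches of `E` and contracts high frequencies. On `L²` it has norm at most `√(k / E_min)`:
Cauchy–Schwarz over the `k` branches, then a change of variables
(`norm_sob_zero_transpose_zero_le`). Each derivative moved through `L` brings out a factor `1 / E'`,
so the part of order `n` gains `E_min⁻ⁿ` and the rest is of lower order, a Lasota–Yorke inequality
(`exists_norm_deriv_transpose_le`). On frequencies above `N` the lower order part is `O(1 / N)`.
Interpolating between `L²` and an integer Sobolev space (`norm_sob_interpolate`) gives, on high
frequencies, a norm below any `ρ > r_m` in `H^{|m|}`; the geometric mean loses nothing (`rm_eq`).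
Dually, the transfer operator followed by the projection to frequencies above `N` has norm at most
`ρ` on `H^m` (`exists_norm_transferHigh_le`), and what was removed has finite rank.

The rest is operator theory from this one fact, `EssNormLE`. Cutting the singular values at `r`
yields a decomposition with `‖R‖ ≤ r` itself, not just `ρ` (`EssNormLE.exists_eq_add_compact`).
Outside the disc of radius `r`, `T - z` is a finite rank perturbation of an invertible operator,
hence Fredholm, and spectral points are eigenvalues. Infinitely many of them beyond some `ρ > r`, or
one of infinite algebraic multiplicity, would give an infinite triangular block with large diagonal,
which `EssNormLE.not_strictMono_triangular` excludes.

Independence of `m` is a regularity statement (`mem_sobolevSpace_of_transfer_sub`): for a common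
cutoff, the high frequency part of `F - z` is invertible on both spaces, so solving in the smaller
space and using uniqueness in the larger one improves the regularity of a solution. -/

/-- The operator `T` is within distance `ρ` of an operator of finite rank, for every `ρ > r`. -/
def EssNormLE {X : Type*} [NormedAddCommGroup X] [NormedSpace ℂ X] (T : X →L[ℂ] X) (r : ℝ) : Prop :=
  ∀ ρ > r, ∃ K : X →L[ℂ] X, FiniteDimensional ℂ (LinearMap.range (K : X →ₗ[ℂ] X)) ∧ ‖T - K‖ ≤ ρ

/-! ### Fredholm property and eigenvalues outside the essential disc -/

section Banach

variable {X : Type*} [NormedAddCommGroup X] [NormedSpace ℂ X]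

lemma isCompactOperator_of_finiteDimensional_range {K : X →L[ℂ] X}
    (hK : FiniteDimensional ℂ (LinearMap.range (K : X →ₗ[ℂ] X))) : IsCompactOperator K := by
  have : ProperSpace (LinearMap.range (K : X →ₗ[ℂ] X)) := FiniteDimensional.proper ℂ _
  have h := isCompactOperator_of_locallyCompactSpace_dom
    (K.codRestrict (LinearMap.range (K : X →ₗ[ℂ] X)) fun x => ⟨x, rfl⟩)
  exact h.clm_comp (LinearMap.range (K : X →ₗ[ℂ] X)).subtypeL

variable [CompleteSpace X]

lemma isUnit_smul_one_sub {R : X →L[ℂ] X} {z : ℂ} (h : ‖R‖ < ‖z‖) : IsUnit (z • 1 - R) := by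
  -- The Neumann series lemma needs `‖1‖ = 1`, which fails on the zero space.
  rcases subsingleton_or_nontrivial X with hX | hX
  · have : z • 1 - R = 1 := ContinuousLinearMap.ext fun x => Subsingleton.elim _ _
    rw [this]; exact isUnit_one
  have := spectrum.mem_resolventSet_of_norm_lt (a := R) (k := z) h
  rwa [spectrum.mem_resolventSet_iff, Algebra.algebraMap_eq_smul_one] at this

namespace EssNormLE

variable {T : X →L[ℂ] X} {r : ℝ}

/-- A finite rank `K` with `‖T - K‖ < ‖z‖` exists, and the Neumann series inverts `z - (T - K)`. So
`z - T` is a finite rank perturbation of a unit. -/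
lemma exists_isUnit (hT : EssNormLE T r) {z : ℂ} (hz : r < ‖z‖) :
    ∃ K : X →L[ℂ] X, FiniteDimensional ℂ (LinearMap.range (K : X →ₗ[ℂ] X)) ∧
      IsUnit (z • 1 - (T - K)) := by
  obtain ⟨ρ, h1, h2⟩ := exists_between hz
  obtain ⟨K, hK, hTK⟩ := hT ρ h1
  exact ⟨K, hK, isUnit_smul_one_sub (hTK.trans_lt h2)⟩

/-- With `T - z = K - u` and `A = u⁻¹`, the operator `-A` is an inverse modulo finite rank: the two
products differ from the identity by `-AK` and `-KA`. -/
lemma isFredholm (hT : EssNormLE T r) {z : ℂ} (hz : r < ‖z‖) :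
    (T - z • ContinuousLinearMap.id ℂ X).IsFredholm := by
  obtain ⟨K, hK, u, hu⟩ := hT.exists_isUnit hz
  have hKn : (K : X →ₗ[ℂ] X).HasNoetherianRange := by
    rw [LinearMap.hasNoetherianRange_iff_range]; infer_instance
  have e : T - z • ContinuousLinearMap.id ℂ X = K - (u : X →L[ℂ] X) := by
    rw [hu]; ext x; simp; abel
  set A : X →L[ℂ] X := ((u⁻¹ : (X →L[ℂ] X)ˣ) : X →L[ℂ] X) with hA
  have h1 : ∀ x, A ((u : X →L[ℂ] X) x) = x := fun x =>
    congrArg (fun B : X →L[ℂ] X => B x) u.inv_mul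
  have h2 : ∀ x, (u : X →L[ℂ] X) (A x) = x := fun x =>
    congrArg (fun B : X →L[ℂ] X => B x) u.mul_inv
  rw [e]
  refine ContinuousLinearMap.IsFredholm.of_isQuasiInverse (v := -A) ⟨?_, ?_⟩
  · refine LinearMap.FiniteRangeSetoid.equiv_iff_hasNoetherianRange.2 ?_
    have h3 := (hKn.comp_left (A : X →ₗ[ℂ] X)).neg
    have h4 : -((A : X →ₗ[ℂ] X) ∘ₗ (K : X →ₗ[ℂ] X)) =
        ((-A : X →L[ℂ] X) : X →ₗ[ℂ] X) ∘ₗ ((K - (u : X →L[ℂ] X) : X →L[ℂ] X) : X →ₗ[ℂ] X) -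
          LinearMap.id := by
      refine LinearMap.ext fun x => ?_
      simp [h1]
    exact h4 ▸ h3
  · refine LinearMap.FiniteRangeSetoid.equiv_iff_hasNoetherianRange.2 ?_
    have h3 := (hKn.comp_right (A : X →ₗ[ℂ] X)).neg
    have h4 : -((K : X →ₗ[ℂ] X) ∘ₗ (A : X →ₗ[ℂ] X)) =
        ((K - (u : X →L[ℂ] X) : X →L[ℂ] X) : X →ₗ[ℂ] X) ∘ₗ ((-A : X →L[ℂ] X) : X →ₗ[ℂ] X) -
          LinearMap.id := by
      refine LinearMap.ext fun x => ?_
      simp [h2]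
    exact h4 ▸ h3

lemma essentialSpectralRadius_le (hT : EssNormLE T r) :
    essentialSpectralRadius T ≤ ENNReal.ofReal r := by
  refine iSup₂_le fun z hz => ?_
  have : ‖z‖ ≤ r := by
    by_contra h
    exact hz (hT.isFredholm (not_le.1 h))
  rw [← enorm_eq_nnnorm, ← ofReal_norm]
  exact ENNReal.ofReal_le_ofReal this

/-- Factor `z - T = u (1 - AK)`. By the Fredholm alternative for the compact operator `AK`, either
`1 - AK` has a kernel, which is then in the kernel of `z - T`, or `z - T` is invertible. -/
lemma hasEigenvalue (hT : EssNormLE T r) {z : ℂ} (hz : r < ‖z‖) (hs : z ∈ spectrum ℂ T) :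
    Module.End.HasEigenvalue (T : X →ₗ[ℂ] X) z := by
  obtain ⟨K, hK, u, hu⟩ := hT.exists_isUnit hz
  set A : X →L[ℂ] X := ((u⁻¹ : (X →L[ℂ] X)ˣ) : X →L[ℂ] X) with hA
  have hc : IsCompactOperator (A * K) :=
    (isCompactOperator_of_finiteDimensional_range hK).clm_comp A
  have e : z • 1 - T = (u : X →L[ℂ] X) * (1 - A * K) := by
    rw [mul_sub, mul_one, ← mul_assoc, hA, Units.mul_inv, one_mul, hu]; abel
  rcases hc.hasEigenvalue_or_mem_resolventSet (one_ne_zero (α := ℂ)) with h | h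
  · obtain ⟨x, hx⟩ := h.exists_hasEigenvector
    refine Module.End.hasEigenvalue_of_hasEigenvector (x := x) ⟨?_, hx.2⟩
    have h1 : (A * K) x = x := by simpa using hx.apply_eq_smul
    have h2 : z • x - T x = (u : X →L[ℂ] X) (x - (A * K) x) :=
      congrArg (fun B : X →L[ℂ] X => B x) e
    rw [h1, sub_self, map_zero, sub_eq_zero] at h2
    rw [Module.End.mem_genEigenspace_one]
    exact h2.symm
  · exfalso
    rw [spectrum.mem_resolventSet_iff, map_one] at h
    apply hs
    rw [spectrum.mem_resolventSet_iff, Algebra.algebraMap_eq_smul_one, e]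
    exact u.isUnit.mul h

end EssNormLE

end Banach

/-! ### Finite multiplicity and discreteness from orthonormal sequences -/

section Hilbert

variable {X : Type*} [NormedAddCommGroup X] [InnerProductSpace ℂ X]

-- Expand `K y` in an orthonormal basis `b i` of the range. By Bessel, `⟨x n, b i⟩ → 0`, while the
-- other factor is bounded by `‖K‖`.
open Filter Topology in
lemma tendsto_inner_orthonormal {K : X →L[ℂ] X}
    (hK : FiniteDimensional ℂ (LinearMap.range (K : X →ₗ[ℂ] X))) {x : ℕ → X}
    (hx : Orthonormal ℂ x) : Tendsto (fun n => inner ℂ (x n) (K (x n))) atTop (𝓝 0) := by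
  let V := LinearMap.range (K : X →ₗ[ℂ] X)
  let b := stdOrthonormalBasis ℂ V
  have h1 : ∀ y : X, inner ℂ y (K y) = ∑ i, inner ℂ y (b i : X) * inner ℂ (b i : X) (K y) := by
    intro y
    have h2 := b.sum_repr' ⟨K y, LinearMap.mem_range_self (K : X →ₗ[ℂ] X) y⟩
    have h3 := congrArg (fun v : V => inner ℂ y (v : X)) h2
    simp only [Submodule.coe_sum, Submodule.coe_smul, inner_sum, inner_smul_right,
      Submodule.coe_inner] at h3
    rw [← h3]
    exact Finset.sum_congr rfl fun i _ => mul_comm _ _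
  simp only [h1]
  rw [← Finset.sum_const_zero (s := (Finset.univ : Finset (Fin (Module.finrank ℂ V))))]
  refine tendsto_finsetSum _ fun i _ => ?_
  have h4 : Tendsto (fun n => ‖inner ℂ (x n) (b i : X)‖) atTop (𝓝 0) := by
    have h5 := (hx.inner_products_summable (x := (b i : X))).tendsto_atTop_zero
    have h6 := h5.sqrt
    simpa using h6
  refine squeeze_zero_norm (a := fun n => ‖inner ℂ (x n) (b i : X)‖ * ‖K‖) (fun n => ?_) ?_
  · rw [norm_mul]
    gcongr
    refine (norm_inner_le_norm _ _).trans ?_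
    have : ‖(b i : X)‖ = 1 := by
      exact b.orthonormal.1 i
    rw [this, one_mul]
    simpa [hx.1 n] using K.le_opNorm (x n)
  · simpa using h4.mul_const ‖K‖

/-- A strictly increasing sequence of complete subspaces on which `T` is upper triangular with
diagonal entries of modulus at least `ρ > r` cannot exist when `T` has essential norm at most
`r`. -/
lemma EssNormLE.not_strictMono_triangular {T : X →L[ℂ] X} {r ρ : ℝ} (hT : EssNormLE T r)
    (hρ : r < ρ) (V : ℕ → Submodule ℂ X) [∀ n, (V n).HasOrthogonalProjection]
    (hV : StrictMono V) (z : ℕ → ℂ)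
    (hz : ∀ n, ρ ≤ ‖z n‖) (hTV : ∀ n, ∀ x ∈ V (n + 1), T x - z n • x ∈ V n) : False := by
  -- Gram–Schmidt: one unit vector in each gap `V (n + 1) ⊖ V n`.
  have h1 : ∀ n, ∃ x ∈ V (n + 1), ‖x‖ = 1 ∧ x ∈ (V n)ᗮ := by
    intro n
    obtain ⟨y, hy1, hy2⟩ := SetLike.exists_of_lt (hV (Nat.lt_succ_self n))
    set w := y - (V n).starProjection y with hw
    have hw0 : w ≠ 0 := by
      intro h
      rw [hw, sub_eq_zero] at h
      exact hy2 (h ▸ Submodule.starProjection_apply_mem _ _)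
    have hwV : w ∈ V (n + 1) := Submodule.sub_mem _ hy1
      (hV.monotone (Nat.le_succ n) (Submodule.starProjection_apply_mem _ _))
    have hwo : w ∈ (V n)ᗮ := (V n).sub_starProjection_mem_orthogonal y
    refine ⟨((‖w‖⁻¹ : ℝ) : ℂ) • w, Submodule.smul_mem _ _ hwV, ?_, Submodule.smul_mem _ _ hwo⟩
    rw [norm_smul, Complex.norm_real, norm_inv, norm_norm, inv_mul_cancel₀ (norm_ne_zero_iff.2 hw0)]
  choose x hxV hx1 hxo using h1
  have hx : Orthonormal ℂ x := by
    refine ⟨hx1, ?_⟩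
    have h : ∀ m n, m < n → inner ℂ (x m) (x n) = 0 := fun m n hmn =>
      hxo n _ (hV.monotone (Nat.succ_le_of_lt hmn) (hxV m))
    intro m n hmn
    rcases lt_or_gt_of_ne hmn with h' | h'
    · exact h m n h'
    · rw [← inner_conj_symm, h n m h', map_zero]
  obtain ⟨ρ', h2, h3⟩ := exists_between hρ
  obtain ⟨K, hK, hTK⟩ := hT ρ' h2
  -- Triangularity makes `z n` the diagonal entry: `T (x n) - z n • x n` lies in `V n`, orthogonal
  -- to `x n`.
  have hd : ∀ n, inner ℂ (x n) (T (x n)) = z n := fun n => by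
    have h4 : inner ℂ (x n) (T (x n) - z n • x n) = 0 := by
      rw [← inner_conj_symm, hxo n _ (hTV n _ (hxV n)), map_zero]
    rw [inner_sub_right, sub_eq_zero, inner_smul_right, inner_self_eq_norm_sq_to_K, hx1] at h4
    simpa using h4
  -- `T - K` accounts for at most `ρ'` of the diagonal, so the diagonal of `K` stays away from `0`,
  -- although it must tend to `0`.
  have h5 : ∀ n, ρ - ρ' ≤ ‖inner ℂ (x n) (K (x n))‖ := fun n => by
    have h6 : inner ℂ (x n) (K (x n)) = z n - inner ℂ (x n) ((T - K) (x n)) := by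
      rw [sub_apply, inner_sub_right, hd]; ring
    have h7 : ‖inner ℂ (x n) ((T - K) (x n))‖ ≤ ρ' := by
      refine (norm_inner_le_norm _ _).trans ?_
      rw [hx1, one_mul]
      refine ((T - K).le_opNorm _).trans ?_
      rwa [hx1, mul_one]
    rw [h6]
    refine le_trans ?_ (norm_sub_norm_le _ _)
    linarith [hz n]
  have h8 := (tendsto_inner_orthonormal hK hx).norm
  rw [norm_zero] at h8
  have := ge_of_tendsto' h8 h5
  linarith

lemma finiteDimensional_ker_pow {f : Module.End ℂ X}
    (hf : FiniteDimensional ℂ (LinearMap.ker f)) (n : ℕ) :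
    FiniteDimensional ℂ (LinearMap.ker (f ^ n)) := by
  induction n with
  | zero =>
    rw [pow_zero, Module.End.one_eq_id, LinearMap.ker_id]; infer_instance
  | succ n ih =>
    rw [pow_succ, Module.End.mul_eq_comp, LinearMap.ker_comp]
    rw [← Submodule.fg_iff_finiteDimensional] at *
    exact Submodule.fg_of_fg_map_of_fg_inf_ker f (Submodule.FG.of_le ih (Submodule.map_comap_le _ _))
      (Submodule.FG.of_le hf inf_le_right)

variable [CompleteSpace X]

namespace EssNormLE

variable {T : X →L[ℂ] X} {r : ℝ}

/-- The kernels of `(T - z)ⁿ` are finite-dimensional. If they never stabilised, they would form a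
strictly increasing chain which `T - z` lowers by one step, a forbidden triangular block with
constant diagonal `z`. -/
lemma finiteDimensional_genEigenspace (hT : EssNormLE T r) {z : ℂ} (hz : r < ‖z‖) :
    FiniteDimensional ℂ (genEigenspace T z) := by
  set f : Module.End ℂ X := (T : X →ₗ[ℂ] X) - algebraMap ℂ (Module.End ℂ X) z with hf
  have hfT : ∀ x, f x = T x - z • x := fun x => by simp [hf]
  have h1 : FiniteDimensional ℂ (LinearMap.ker f) := by
    have h2 := (hT.isFredholm hz).finite_ker
    have h3 : f = ((T - z • ContinuousLinearMap.id ℂ X : X →L[ℂ] X) : X →ₗ[ℂ] X) := by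
      ext x; simp [hfT]
    rw [h3]; exact h2
  have h2 : ∀ n, FiniteDimensional ℂ (LinearMap.ker (f ^ n)) := finiteDimensional_ker_pow h1
  have hmono : Monotone fun n => LinearMap.ker (f ^ n) := by
    refine monotone_nat_of_le_succ fun n x hx => ?_
    rw [LinearMap.mem_ker] at *
    rw [pow_succ', Module.End.mul_apply, hx, map_zero]
  obtain ⟨n, hn⟩ : ∃ n, LinearMap.ker (f ^ n) = LinearMap.ker (f ^ (n + 1)) := by
    by_contra! h
    refine hT.not_strictMono_triangular hz (fun n => LinearMap.ker (f ^ n))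
      (strictMono_nat_of_lt_succ fun n => lt_of_le_of_ne (hmono (Nat.le_succ n)) (h n))
      (fun _ => z) (fun _ => le_rfl) fun n x hx => ?_
    rw [← hfT, LinearMap.mem_ker]
    rw [LinearMap.mem_ker, pow_succ] at hx
    exact hx
  have h3 : ∀ k, LinearMap.ker (f ^ (n + k)) = LinearMap.ker (f ^ n) := fun k =>
    (Module.End.ker_pow_constant hn k).symm
  have h4 : genEigenspace T z ≤ LinearMap.ker (f ^ n) := by
    intro x hx
    rw [genEigenspace, Module.End.mem_maxGenEigenspace] at hx
    obtain ⟨k, hk⟩ := hx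
    rw [← h3 k]
    refine hmono (Nat.le_add_left k n) ?_
    exact hk
  exact Submodule.finiteDimensional_of_le h4

/-- Eigenvectors `v n` of infinitely many distinct eigenvalues are independent. On the spans of the
first `n` of them `T` is triangular, since `T - z n` kills `v n` and preserves the earlier lines. -/
lemma finite_spectrum (hT : EssNormLE T r) {ρ : ℝ} (hρ : r < ρ) :
    (spectrum ℂ T ∩ {z | ρ ≤ ‖z‖}).Finite := by
  by_contra hinf
  have hinf : (spectrum ℂ T ∩ {z | ρ ≤ ‖z‖}).Infinite := hinf
  set z : ℕ → ℂ := fun n => (hinf.natEmbedding _ n : ℂ) with hz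
  have hzi : Function.Injective z := fun a b h =>
    (hinf.natEmbedding _).injective (Subtype.ext h)
  have hz1 : ∀ n, z n ∈ spectrum ℂ T := fun n => (hinf.natEmbedding _ n).2.1
  have hz2 : ∀ n, ρ ≤ ‖z n‖ := fun n => (hinf.natEmbedding _ n).2.2
  have hev : ∀ n, ∃ v, Module.End.HasEigenvector (T : X →ₗ[ℂ] X) (z n) v := fun n =>
    (hT.hasEigenvalue (hρ.trans_le (hz2 n)) (hz1 n)).exists_hasEigenvector
  choose v hv using hev
  have hli : LinearIndependent ℂ v :=
    Module.End.eigenvectors_linearIndependent' (T : X →ₗ[ℂ] X) z hzi v hv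
  have hfin : ∀ n, FiniteDimensional ℂ (Submodule.span ℂ (v '' Set.Iio n)) := fun n =>
    FiniteDimensional.span_of_finite ℂ ((Set.finite_Iio n).image v)
  refine hT.not_strictMono_triangular hρ (fun n => Submodule.span ℂ (v '' Set.Iio n))
    (strictMono_nat_of_lt_succ fun n => ?_) z hz2 fun n x hx => ?_
  · refine lt_of_le_of_ne (Submodule.span_mono (Set.image_mono
      (Set.Iio_subset_Iio (Nat.le_succ n)))) fun h => ?_
    have h1 : v n ∈ Submodule.span ℂ (v '' Set.Iio n) := by
      rw [h]; exact Submodule.subset_span ⟨n, Nat.lt_succ_self n, rfl⟩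
    exact (hli.notMem_span_image (s := Set.Iio n) (x := n) (by simp)) h1
  · induction hx using Submodule.span_induction with
    | mem x hx =>
      obtain ⟨i, hi, rfl⟩ := hx
      have h1 : T (v i) = z i • v i := (hv i).apply_eq_smul
      rw [h1, ← sub_smul]
      rcases (Nat.lt_succ_iff.1 hi).eq_or_lt with rfl | hi'
      · simp
      · exact Submodule.smul_mem _ _ (Submodule.subset_span ⟨i, hi', rfl⟩)
    | zero => simp
    | add a b _ _ ha hb =>
      have : T (a + b) - z n • (a + b) = (T a - z n • a) + (T b - z n • b) := by
        rw [map_add, smul_add]; abel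
      rw [this]; exact Submodule.add_mem _ ha hb
    | smul c a _ ha =>
      have : T (c • a) - z n • (c • a) = c • (T a - z n • a) := by
        rw [map_smul, smul_sub, smul_comm]
      rw [this]; exact Submodule.smul_mem _ _ ha

lemma isDiscreteEigenvalue (hT : EssNormLE T r) {z : ℂ} (hz : r < ‖z‖) (hs : z ∈ spectrum ℂ T) :
    IsDiscreteEigenvalue T z := by
  refine ⟨hT.hasEigenvalue hz hs, hT.finiteDimensional_genEigenspace hz, ?_⟩
  obtain ⟨ρ, h1, h2⟩ := exists_between hz
  have hfin := (hT.finite_spectrum h1).subset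
    (Set.sdiff_subset (s := spectrum ℂ T ∩ {z | ρ ≤ ‖z‖}) (t := {z}))
  have ho : IsOpen (((spectrum ℂ T ∩ {z | ρ ≤ ‖z‖}) \ {z})ᶜ) := hfin.isClosed.isOpen_compl
  obtain ⟨δ, hδ, hball⟩ := Metric.isOpen_iff.1 ho z (by simp)
  -- The bound `‖z‖ - ρ` keeps `w` in the region `ρ ≤ ‖w‖` where the spectrum is finite.
  refine ⟨min δ (‖z‖ - ρ), lt_min hδ (by linarith), fun w hw hwz => ?_⟩
  by_contra hne
  refine hball (a := w) ?_ ⟨⟨hw, ?_⟩, hne⟩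
  · rw [Metric.mem_ball, dist_eq_norm]; exact hwz.trans_le (min_le_left _ _)
  · have h3 := hwz.trans_le (min_le_right _ _)
    have h4 := norm_sub_norm_le z w
    rw [norm_sub_rev] at h4
    change ρ ≤ ‖w‖
    linarith

end EssNormLE

end Hilbert

/-! ### A compact perturbation of norm exactly at most the essential norm -/

section BestApproximation

variable {X : Type*} [NormedAddCommGroup X] [InnerProductSpace ℂ X] [CompleteSpace X]
  {T : X →L[ℂ] X} {r : ℝ}

open ContinuousLinearMap

lemma re_inner_cfc_nonneg {S : X →L[ℂ] X} {f : ℝ → ℝ} (hf : ∀ t ∈ spectrum ℝ S, 0 ≤ f t) (x : X) :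
    0 ≤ (inner ℂ (cfc f S x) x).re := by
  have h : 0 ≤ cfc f S := cfc_nonneg hf
  have := (nonneg_iff_isPositive _).1 h
  exact this.re_inner_nonneg_left x

lemma norm_adjoint_sq (T : X →L[ℂ] X) (x : X) :
    ‖adjoint T x‖ ^ 2 = (inner ℂ ((T * adjoint T) x) x).re := by
  have h : inner ℂ ((T * adjoint T) x) x = inner ℂ (adjoint T x) (adjoint T x) := by
    exact (adjoint_inner_right T (adjoint T x) x).symm
  rw [h, inner_self_eq_norm_sq_to_K]
  norm_cast

/-- A function of `T T*` vanishing on `[0, ρ²]` has finite rank when `ρ > r`. -/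
lemma EssNormLE.finiteDimensional_range_cfc (hT : EssNormLE T r) {ρ : ℝ} (hρ : r < ρ)
    {h : ℝ → ℝ} (hh : Continuous h) (hh0 : ∀ t, h t ≠ 0 → ρ ^ 2 ≤ t) :
    FiniteDimensional ℂ (LinearMap.range ((cfc h (T * adjoint T) : X →L[ℂ] X) : X →ₗ[ℂ] X)) := by
  set S := T * adjoint T with hS
  have hSa : IsSelfAdjoint S := IsSelfAdjoint.mul_star_self T
  obtain ⟨ρ', h1, h2⟩ := exists_between hρ
  obtain ⟨K, hK, hTK⟩ := hT ρ' h1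
  -- On the range of `h(S)` one has `S ≥ ρ²`, because `h(t) (t - ρ²) h(t) ≥ 0` for every `t`.
  have hlow : ∀ u, ρ ^ 2 * ‖cfc h S u‖ ^ 2 ≤ ‖adjoint T (cfc h S u)‖ ^ 2 := fun u => by
    have e1 : cfc (fun t => h t * ((t - ρ ^ 2) * h t)) S =
        cfc h S * ((S - (ρ ^ 2 : ℝ) • 1) * cfc h S) := by
      rw [cfc_mul h (fun t => (t - ρ ^ 2) * h t) S (by fun_prop) (by fun_prop),
        cfc_mul (fun t => t - ρ ^ 2) h S (by fun_prop) (by fun_prop),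
        cfc_sub (fun t => t) (fun _ => ρ ^ 2) S (by fun_prop) (by fun_prop),
        cfc_id' ℝ S, cfc_const (ρ ^ 2) S, Algebra.algebraMap_eq_smul_one]
    have e2 := re_inner_cfc_nonneg (S := S) (f := fun t => h t * ((t - ρ ^ 2) * h t))
      (fun t _ => by
        by_cases ht : h t = 0
        · simp [ht]
        · have := hh0 t ht
          nlinarith [mul_nonneg (sub_nonneg.2 this) (mul_self_nonneg (h t))]) u
    have e3 : adjoint (cfc h S) = cfc h S := (cfc_predicate h S : IsSelfAdjoint (cfc h S))
    have e5 : inner ℂ ((cfc h S * ((S - (ρ ^ 2 : ℝ) • 1) * cfc h S)) u) u =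
        inner ℂ ((S - (ρ ^ 2 : ℝ) • 1) (cfc h S u)) (cfc h S u) := by
      have := adjoint_inner_right (cfc h S) ((S - (ρ ^ 2 : ℝ) • 1) (cfc h S u)) u
      rw [e3] at this
      exact this.symm
    rw [e1, e5, sub_apply, inner_sub_left, Complex.sub_re, ← norm_adjoint_sq] at e2
    have e4 : (inner ℂ (((ρ ^ 2 : ℝ) • (1 : X →L[ℂ] X)) (cfc h S u)) (cfc h S u)).re =
        ρ ^ 2 * ‖cfc h S u‖ ^ 2 := by
      have : ((ρ ^ 2 : ℝ) • (1 : X →L[ℂ] X)) (cfc h S u) = ((ρ ^ 2 : ℝ) : ℂ) • cfc h S u :=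
        rfl
      rw [this, inner_smul_left, inner_self_eq_norm_sq_to_K, Complex.conj_ofReal]
      norm_cast
      exact Complex.re_ofReal_mul _ _
    linarith
  set V := LinearMap.range (K : X →ₗ[ℂ] X) with hV
  -- The projection to the range of `K` is injective on the range of `h(S)`: if `v` is orthogonal to
  -- the range of `K`, then `K* v = 0` and `‖T* v‖ ≤ ρ' ‖v‖`, against the lower bound `ρ ‖v‖`.
  let p : LinearMap.range ((cfc h S : X →L[ℂ] X) : X →ₗ[ℂ] X) →ₗ[ℂ] V :=
    (V.orthogonalProjectionOnto : X →ₗ[ℂ] V) ∘ₗ (LinearMap.range ((cfc h S : X →L[ℂ] X) : X →ₗ[ℂ] X)).subtype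
  refine FiniteDimensional.of_injective p ?_
  rw [← LinearMap.ker_eq_bot, LinearMap.ker_eq_bot']
  rintro ⟨v, u, rfl⟩ hv
  have hv : cfc h S u ∈ Vᗮ := (Submodule.orthogonalProjectionOnto_eq_zero_iff).1 hv
  have hKv : adjoint K (cfc h S u) = 0 := by
    refine ext_inner_right ℂ fun w => ?_
    rw [adjoint_inner_left, inner_zero_left, ← inner_conj_symm]
    exact (congrArg _ (hv _ ⟨w, rfl⟩)).trans (map_zero _)
  have hup : ‖adjoint T (cfc h S u)‖ ≤ ρ' * ‖cfc h S u‖ := by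
    have e1 : adjoint T (cfc h S u) = adjoint (T - K) (cfc h S u) := by
      rw [map_sub, sub_apply, hKv, sub_zero]
    rw [e1]
    refine (le_opNorm _ _).trans ?_
    gcongr
    rwa [LinearIsometryEquiv.norm_map]
  have h3 := hlow u
  apply Subtype.ext
  change cfc h S u = 0
  by_contra hne
  have hpos : 0 < ‖cfc h S u‖ := norm_pos_iff.2 hne
  have h4 : ρ * ‖cfc h S u‖ ≤ ‖adjoint T (cfc h S u)‖ := by
    rw [← mul_pow] at h3
    exact le_of_sq_le_sq h3 (norm_nonneg _)
  have := h4.trans hup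
  nlinarith

/-- An operator of essential norm at most `r` on a Hilbert space is the sum of an operator of norm
at most `r` and a compact operator. -/
lemma EssNormLE.exists_eq_add_compact (hT : EssNormLE T r) (hr : 0 < r) :
    ∃ R K : X →L[ℂ] X, T = R + K ∧ IsCompactOperator K ∧ ‖R‖ ≤ r := by
  set S := T * adjoint T with hS
  have hSa : IsSelfAdjoint S := IsSelfAdjoint.mul_star_self T
  have hS0 : 0 ≤ S := mul_star_self_nonneg T
  have hmax : ∀ t, 0 < max r (Real.sqrt t) := fun t => lt_max_of_lt_left hr
  -- `g(t) = min(1, r / √t)`, so that `g(T T*) T` is `T` with its singular values cut at `r`. The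
  -- form with `max` is visibly continuous.
  set g : ℝ → ℝ := fun t => r / max r (Real.sqrt t) with hg
  have hgc : Continuous g := continuous_const.div
    (continuous_const.max Real.continuous_sqrt) fun t => (hmax t).ne'
  refine ⟨cfc g S * T, (1 - cfc g S) * T, by rw [sub_mul, one_mul]; abel, ?_, ?_⟩
  · have e1 : 1 - cfc g S = cfc (fun t => 1 - g t) S := by
      rw [cfc_sub (fun _ => 1) g S (by fun_prop) (by fun_prop), cfc_const_one ℝ S]
    rw [e1]
    refine IsCompactOperator.comp_clm (f := ⇑(cfc (fun t => 1 - g t) S : X →L[ℂ] X)) ?_ T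
    have := left_nhdsWithin_Ioo_neBot (zero_lt_one (α := ℝ))
    -- `1 - g` vanishes only up to `r²`, where the spectrum may still accumulate. Its truncation `(1
    -- - g - ε)⁺` is within `ε` and vanishes for `√t < r (1 + ε)`, since there `g ≥ 1 / (1 + ε) ≥ 1
    -- - ε`; hence it gives finite rank operators.
    refine isCompactOperator_of_tendsto (l := nhdsWithin (0 : ℝ) (Set.Ioo 0 1))
      (F := fun ε => cfc (fun t => max (1 - g t - ε) 0) S) ?_ ?_
    · rw [tendsto_iff_norm_sub_tendsto_zero]
      refine squeeze_zero' (g := fun ε : ℝ => ε) (Filter.Eventually.of_forall fun _ => norm_nonneg _)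
        ?_ (Filter.tendsto_id.mono_left nhdsWithin_le_nhds)
      filter_upwards [self_mem_nhdsWithin] with ε hε
      rw [← cfc_sub _ _ S (by fun_prop) (by fun_prop)]
      refine norm_cfc_le hε.1.le fun t _ => ?_
      have h0 : g t ≤ 1 := (div_le_one (hmax t)).2 (le_max_left _ _)
      have := hε.1
      rw [Real.norm_eq_abs, abs_le]
      constructor
      · linarith [le_max_left (1 - g t - ε) 0]
      · rcases max_cases (1 - g t - ε) 0 with h | h <;> linarith
    · filter_upwards [self_mem_nhdsWithin] with ε hε
      refine isCompactOperator_of_finiteDimensional_range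
        (hT.finiteDimensional_range_cfc (ρ := r * (1 + ε)) (by nlinarith [hε.1])
          (by fun_prop) fun t ht => ?_)
      by_contra hlt
      apply ht
      apply max_eq_right
      have hε0 := hε.1
      have h1 : Real.sqrt t ≤ r * (1 + ε) := by
        rw [Real.sqrt_le_left (by positivity)]; linarith
      have h2 : max r (Real.sqrt t) ≤ r * (1 + ε) := max_le (by nlinarith) h1
      have h3 : 1 - ε ≤ g t := by
        rw [hg, le_div_iff₀ (hmax t)]
        have h5 : (1 - ε) * max r (Real.sqrt t) ≤ (1 - ε) * (r * (1 + ε)) :=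
          mul_le_mul_of_nonneg_left h2 (by linarith [hε.2])
        nlinarith [mul_pos hr (mul_pos hε0 hε0)]
      linarith
  -- C*-identity: `‖R‖² = ‖R R*‖` with `R R* = g(S) S g(S)`, and `√t g(t) ≤ r`.
  · have e0 : star (cfc g S) = cfc g S := (cfc_predicate g S : IsSelfAdjoint (cfc g S))
    have e1 : (cfc g S * T) * star (cfc g S * T) = cfc (fun t => g t * (t * g t)) S := by
      rw [cfc_mul g (fun t => t * g t) S (by fun_prop) (by fun_prop),
        cfc_mul (fun t => t) g S (by fun_prop) (by fun_prop), cfc_id' ℝ S, star_mul, e0]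
      simp only [mul_assoc]
      rw [hS, star_eq_adjoint, mul_assoc]
    have e2 : ‖cfc g S * T‖ * ‖cfc g S * T‖ ≤ r * r := by
      rw [← CStarRing.norm_self_mul_star, e1]
      refine norm_cfc_le (by positivity) fun t ht => ?_
      have ht0 : 0 ≤ t := spectrum_nonneg_of_nonneg hS0 ht
      rw [Real.norm_of_nonneg (by have := (hmax t).le; positivity)]
      have h1 : Real.sqrt t * g t ≤ r := by
        rw [hg, mul_div_assoc', div_le_iff₀ (hmax t), mul_comm]
        gcongr
        exact le_max_right _ _
      have h2 : 0 ≤ Real.sqrt t * g t := by have := (hmax t).le; positivity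
      calc g t * (t * g t) = (Real.sqrt t * g t) * (Real.sqrt t * g t) := by
            linear_combination -(g t * g t) * Real.mul_self_sqrt ht0
        _ ≤ r * r := mul_self_le_mul_self h2 h1
    exact abs_le_of_sq_le_sq' (by nlinarith) hr.le |>.2

end BestApproximation

/-! ### Comparison of norms in `ℓ²(ℤ)` -/

section Ell2

/-- The space `ℓ²(ℤ)`. -/
abbrev Ell2 := lp (fun _ : ℤ => ℂ) 2

lemma ell2_norm_sq (u : Ell2) : ‖u‖ ^ 2 = ∑' n, ‖u n‖ ^ 2 := by
  have h := lp.norm_rpow_eq_tsum (p := 2) (by norm_num) u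
  simpa using h

lemma ell2_summable (u : Ell2) : Summable fun n => ‖u n‖ ^ 2 := (memlp_two_iff _).1 u.2

lemma ell2_sum_le (u : Ell2) (s : Finset ℤ) : ∑ n ∈ s, ‖u n‖ ^ 2 ≤ ‖u‖ ^ 2 := by
  rw [ell2_norm_sq]
  exact (ell2_summable u).sum_le_tsum s fun _ _ => by positivity

lemma ell2_norm_le_of_sum_le {u : Ell2} {C : ℝ} (hC : 0 ≤ C)
    (h : ∀ s : Finset ℤ, ∑ n ∈ s, ‖u n‖ ^ 2 ≤ C ^ 2) : ‖u‖ ≤ C := by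
  refine le_of_sq_le_sq ?_ hC
  rw [ell2_norm_sq]
  exact (ell2_summable u).tsum_le_of_sum_le h

lemma ell2_norm_le_mul {u v : Ell2} {c : ℝ} (hc : 0 ≤ c) (h : ∀ n, ‖u n‖ ≤ c * ‖v n‖) :
    ‖u‖ ≤ c * ‖v‖ := by
  refine ell2_norm_le_of_sum_le (by positivity) fun s => ?_
  rw [mul_pow]
  refine le_trans ?_ (mul_le_mul_of_nonneg_left (ell2_sum_le v s) (by positivity))
  rw [Finset.mul_sum]
  refine Finset.sum_le_sum fun n _ => ?_
  rw [← mul_pow]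
  exact pow_le_pow_left₀ (norm_nonneg _) (h n) 2

/-- The sequence of absolute values. -/
def ell2Abs (u : Ell2) : Ell2 :=
  ⟨fun n => ((‖u n‖ : ℝ) : ℂ), (memlp_two_iff _).2 (by simpa using ell2_summable u)⟩

lemma ell2Abs_apply (u : Ell2) (n : ℤ) : ell2Abs u n = ((‖u n‖ : ℝ) : ℂ) := rfl

lemma norm_ell2Abs (u : Ell2) : ‖ell2Abs u‖ ≤ ‖u‖ := by
  simpa using ell2_norm_le_mul (u := ell2Abs u) (v := u) zero_le_one
    (fun n => by simp [ell2Abs_apply])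

/-- Passing to absolute values turns the pointwise bound into domination by a single vector, to
which the triangle inequality applies. -/
lemma ell2_norm_le_add_mul {u v w : Ell2} {c : ℝ} (hc : 0 ≤ c)
    (h : ∀ n, ‖u n‖ ≤ ‖v n‖ + c * ‖w n‖) : ‖u‖ ≤ ‖v‖ + c * ‖w‖ := by
  have h1 : ‖u‖ ≤ 1 * ‖ell2Abs v + (c : ℂ) • ell2Abs w‖ := by
    refine ell2_norm_le_mul zero_le_one fun n => ?_
    have e : (ell2Abs v + (c : ℂ) • ell2Abs w) n = ((‖v n‖ + c * ‖w n‖ : ℝ) : ℂ) := by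
      change ell2Abs v n + (c : ℂ) * ell2Abs w n = _
      simp [ell2Abs_apply]
    rw [e, Complex.norm_real, Real.norm_of_nonneg (by positivity), one_mul]
    exact h n
  rw [one_mul] at h1
  refine h1.trans ((norm_add_le _ _).trans ?_)
  rw [norm_smul, Complex.norm_real, Real.norm_of_nonneg hc]
  gcongr
  · exact norm_ell2Abs v
  · exact norm_ell2Abs w

end Ell2

/-! ### Fourier coefficients of smooth functions -/

lemma bracket_sq (n : ℤ) : bracket n ^ 2 = 1 + (n : ℝ) ^ 2 := Real.sq_sqrt (by positivity)

lemma one_le_bracket (n : ℤ) : 1 ≤ bracket n := by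
  rw [bracket, Real.one_le_sqrt]; nlinarith [sq_nonneg (n : ℝ)]

lemma abs_le_bracket (n : ℤ) : |(n : ℝ)| ≤ bracket n := by
  rw [← Real.sqrt_sq_eq_abs]; exact Real.sqrt_le_sqrt (by linarith)

lemma bracket_le_abs_add_one (n : ℤ) : bracket n ≤ |(n : ℝ)| + 1 := by
  rw [bracket, Real.sqrt_le_left (by positivity), ← sq_abs (n : ℝ)]
  nlinarith [abs_nonneg (n : ℝ)]

lemma bracket_neg (n : ℤ) : bracket (-n) = bracket n := by simp [bracket]

lemma summable_inv_bracket_sq : Summable fun n : ℤ => (bracket n ^ 2)⁻¹ := by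
  have h := Real.summable_one_div_int_pow (p := 2) |>.2 one_lt_two
  refine h.of_norm_bounded_eventually ?_
  have : ({0} : Set ℤ)ᶜ ∈ Filter.cofinite := (Set.finite_singleton 0).compl_mem_cofinite
  filter_upwards [this] with n hn
  have hn : (n : ℝ) ≠ 0 := by simpa using hn
  rw [bracket_sq, Real.norm_of_nonneg (by positivity), one_div]
  gcongr
  linarith

/-- The Fourier coefficient of a smooth function, as a linear functional. -/
def coeff (n : ℤ) : SmoothCircle →ₗ[ℂ] ℂ := (ofSmooth (fourierMode (-n))).1

lemma coeff_eq (n : ℤ) (φ : SmoothCircle) : coeff n φ = fourierCoeff (toCircle φ) n :=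
  (fourierCoeff_toCircle φ n).symm

lemma fourierMode_one (n : ℤ) : (fourierMode n).1 1 = (fourierMode n).1 0 := by
  simpa using (fourierMode n).2.2 0

lemma fourierMode_mul (k n : ℤ) (x : ℝ) :
    (fourierMode k).1 x * (fourierMode n).1 x = (fourierMode (k + n)).1 x := by
  simp only [fourierMode]
  rw [← Complex.exp_add]
  congr 1; push_cast; ring

lemma coeff_fourierMode (n k : ℤ) : coeff n (fourierMode k) = if n = k then 1 else 0 := by
  change ∫ x in (0 : ℝ)..1, (fourierMode (-n)).1 x * (fourierMode k).1 x = _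
  simp only [fourierMode_mul]
  split_ifs with h
  · subst h
    simp [fourierMode]
  · have hl : (2 * Real.pi * Complex.I * ((-n + k : ℤ) : ℂ)) ≠ 0 := by
      refine mul_ne_zero Complex.two_pi_I_ne_zero ?_
      exact_mod_cast fun h' => h (by omega)
    have h1 := intervalIntegral.integral_eq_sub_of_hasDerivAt (a := 0) (b := 1)
      (fun x _ => fourierMode_hasDerivAt (-n + k) x)
      ((continuous_const.mul (fourierMode (-n + k)).2.1.continuous).intervalIntegrable _ _)
    rw [intervalIntegral.integral_const_mul, fourierMode_one, sub_self] at h1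
    exact (mul_eq_zero.1 h1).resolve_left hl

lemma norm_toCircle_le {φ : SmoothCircle} {M : ℝ} (h : ∀ x, ‖φ.1 x‖ ≤ M) : ‖toCircle φ‖ ≤ M := by
  rw [ContinuousMap.norm_le _ ((norm_nonneg _).trans (h 0))]
  intro x
  induction x using QuotientAddGroup.induction_on with
  | H x => exact h x

lemma norm_pow_mul_coeff_le {φ : SmoothCircle} {j : ℕ} {M : ℝ}
    (h : ∀ x, ‖iteratedDeriv j φ.1 x‖ ≤ M) (n : ℤ) : |(n : ℝ)| ^ j * ‖coeff n φ‖ ≤ M := by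
  have h1 := (norm_fourierCoeff_le ⟨iteratedDeriv j φ.1, iteratedDeriv_mem φ.2 j⟩ n).trans
    (norm_toCircle_le h)
  rw [fourierCoeff_iteratedDeriv, norm_mul, ← coeff_eq, norm_pow] at h1
  refine le_trans ?_ h1
  gcongr
  have : ‖(2 * Real.pi * Complex.I * n : ℂ)‖ = 2 * Real.pi * |(n : ℝ)| := by
    simp [abs_of_pos Real.pi_pos]
  rw [this]
  nlinarith [abs_nonneg (n : ℝ), Real.pi_gt_three]

lemma bracket_pow_mul_coeff_le {φ : SmoothCircle} {p : ℕ} {M : ℝ}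
    (h : CNBound (2 * p) φ.1 M) (n : ℤ) : bracket n ^ (2 * p) * ‖coeff n φ‖ ≤ 2 ^ p * M := by
  have h0 := norm_pow_mul_coeff_le (h 0 (Nat.zero_le _)) n
  have h1 := norm_pow_mul_coeff_le (h (2 * p) le_rfl) n
  rw [pow_zero, one_mul] at h0
  rw [pow_mul, bracket_sq]
  rw [pow_mul, sq_abs] at h1
  -- `1 + n² ≤ 2 n²` fails only at `n = 0`, where the sup norm of `φ` is used instead.
  rcases eq_or_ne n 0 with rfl | hn
  · have : (1 : ℝ) ≤ 2 ^ p := one_le_pow₀ one_le_two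
    simp only [Int.cast_zero]
    norm_num
    nlinarith [norm_nonneg (coeff 0 φ)]
  · have hn1 : (1 : ℝ) ≤ (n : ℝ) ^ 2 := by
      have : (1 : ℤ) ≤ n ^ 2 := by have := pow_pos (abs_pos.2 hn) 2; rw [sq_abs] at this; omega
      exact_mod_cast this
    calc (1 + (n : ℝ) ^ 2) ^ p * ‖coeff n φ‖ ≤ (2 * (n : ℝ) ^ 2) ^ p * ‖coeff n φ‖ := by
          gcongr; linarith
      _ = 2 ^ p * (((n : ℝ) ^ 2) ^ p * ‖coeff n φ‖) := by rw [mul_pow]; ring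
      _ ≤ _ := by gcongr

lemma exists_CNBound (φ : SmoothCircle) (N : ℕ) : ∃ M, CNBound N φ.1 M := by
  obtain ⟨B, _, hB⟩ := ExpandingData.uniform_bound one_ne_zero φ.2.1 φ.2.2 N
  exact ⟨B, hB⟩

/-- The order of differentiability needed to control `⟨n⟩^{s+2} φ̂(n)`. -/
def decayOrder (s : ℝ) : ℕ := ⌈|s|⌉₊ + 1

/-- `2 * decayOrder s ≥ s + 2`; the two spare powers of the bracket give a summable majorant. -/
lemma bracket_rpow_mul_coeff_le (s : ℝ) {φ : SmoothCircle} {M : ℝ}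
    (h : CNBound (2 * decayOrder s) φ.1 M) (n : ℤ) :
    bracket n ^ s * ‖coeff n φ‖ ≤ 2 ^ decayOrder s * M * (bracket n ^ 2)⁻¹ := by
  rw [← div_eq_mul_inv, le_div_iff₀ (pow_pos (bracket_pos n) 2)]
  refine le_trans ?_ (bracket_pow_mul_coeff_le h n)
  rw [mul_right_comm]
  gcongr
  rw [← Real.rpow_natCast, ← Real.rpow_natCast, ← Real.rpow_add (bracket_pos n)]
  refine Real.rpow_le_rpow_of_exponent_le (one_le_bracket n) ?_
  have h1 := Nat.le_ceil |s|
  have h2 := le_abs_self s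
  have h3 := abs_nonneg s
  simp only [decayOrder]
  push_cast
  linarith

lemma summable_bracket_rpow_mul_coeff (s : ℝ) (φ : SmoothCircle) :
    Summable fun n => bracket n ^ s * ‖coeff n φ‖ := by
  obtain ⟨M, hM⟩ := exists_CNBound φ (2 * decayOrder s)
  refine Summable.of_nonneg_of_le (fun n => ?_) (fun n => bracket_rpow_mul_coeff_le s hM n)
    (summable_inv_bracket_sq.mul_left _)
  have := Real.rpow_nonneg (bracket_pos n).le s
  positivity

/-! ### Sobolev norms of smooth functions -/

lemma memlp_sob (s : ℝ) (φ : SmoothCircle) :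
    Memℓp (E := fun _ : ℤ => ℂ) (fun n => ((bracket n ^ s : ℝ) : ℂ) * coeff n φ) 2 := by
  refine Memℓp.of_exponent_ge (q := 1) ?_ (by norm_num)
  rw [memℓp_gen_iff (by norm_num)]
  refine (summable_bracket_rpow_mul_coeff s φ).congr fun n => ?_
  rw [norm_mul, Complex.norm_real, Real.norm_of_nonneg (Real.rpow_nonneg (bracket_pos n).le s)]
  simp

/-- The sequence `⟨n⟩^s φ̂(n)`. Its norm is the `H^s` norm of `φ`. -/
def sob (s : ℝ) : SmoothCircle →ₗ[ℂ] Ell2 where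
  toFun φ := ⟨fun n => ((bracket n ^ s : ℝ) : ℂ) * coeff n φ, memlp_sob s φ⟩
  map_add' φ ψ := by
    apply Subtype.ext; funext n
    change ((bracket n ^ s : ℝ) : ℂ) * coeff n (φ + ψ) =
      ((bracket n ^ s : ℝ) : ℂ) * coeff n φ + ((bracket n ^ s : ℝ) : ℂ) * coeff n ψ
    rw [map_add, mul_add]
  map_smul' c φ := by
    apply Subtype.ext; funext n
    change ((bracket n ^ s : ℝ) : ℂ) * coeff n (c • φ) = c * (((bracket n ^ s : ℝ) : ℂ) * coeff n φ)
    rw [map_smul, smul_eq_mul]; ring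

lemma sob_apply (s : ℝ) (φ : SmoothCircle) (n : ℤ) :
    sob s φ n = ((bracket n ^ s : ℝ) : ℂ) * coeff n φ := rfl

lemma norm_sob_apply (s : ℝ) (φ : SmoothCircle) (n : ℤ) :
    ‖sob s φ n‖ = bracket n ^ s * ‖coeff n φ‖ := by
  rw [sob_apply, norm_mul, Complex.norm_real,
    Real.norm_of_nonneg (Real.rpow_nonneg (bracket_pos n).le s)]

lemma norm_sob_mono {s t : ℝ} (hst : s ≤ t) (φ : SmoothCircle) : ‖sob s φ‖ ≤ ‖sob t φ‖ := by
  rw [← one_mul ‖sob t φ‖]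
  refine ell2_norm_le_mul zero_le_one fun n => ?_
  rw [norm_sob_apply, norm_sob_apply, one_mul]
  gcongr
  exact one_le_bracket n

/-! ### Pairing of distributions with smooth functions -/

open Filter Topology in
lemma tendsto_apply_fourierPartialSum (α : CircleDistribution) (φ : SmoothCircle) :
    Tendsto (fun s => α.1 (fourierPartialSum φ s)) atTop (𝓝 (α.1 φ)) := by
  obtain ⟨N, C, hC⟩ := α.2
  rw [tendsto_iff_norm_sub_tendsto_zero, Metric.tendsto_nhds]
  intro ε hε
  filter_upwards [eventually_CNBound φ N (ε := ε / (|C| + 1)) (by positivity)] with s hs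
  have h := hC _ _ hs
  rw [map_sub] at h
  rw [dist_zero_right, norm_norm, norm_sub_rev]
  refine h.trans_lt ?_
  rw [mul_div_assoc', div_lt_iff₀ (by positivity)]
  nlinarith [le_abs_self C]

/-- Duality of `H^m` and `H^{-m}`: Cauchy–Schwarz on Fourier partial sums, then the limit. Mode `n`
of `φ` meets the coefficient of `α` at `-n`, and the weights cancel. -/
lemma norm_apply_le (m : ℝ) (α : SobolevSpace m) (φ : SmoothCircle) :
    ‖α.1.1 φ‖ ≤ ‖α‖ * ‖sob (-m) φ‖ := by
  refine le_of_tendsto (tendsto_apply_fourierPartialSum α.1 φ).norm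
    (Filter.Eventually.of_forall fun s => ?_)
  rw [fourierPartialSum, map_sum]
  have h1 : ∀ n, ‖α.1.1 (fourierCoeff (toCircle φ) n • fourierMode n)‖ =
      ‖toEll2 m α (-n)‖ * ‖sob (-m) φ n‖ := fun n => by
    have e : toEll2 m α (-n) = ((bracket (-n) ^ m : ℝ) : ℂ) * α.1.1 (fourierMode (- -n)) := rfl
    have h2 := Real.rpow_pos_of_pos (bracket_pos n) m
    rw [map_smul, norm_smul, norm_sob_apply, e, norm_mul, neg_neg, bracket_neg, Complex.norm_real,
      Real.norm_of_nonneg h2.le, Real.rpow_neg (bracket_pos n).le, coeff_eq]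
    field_simp
  have h2 : ∑ n ∈ s, ‖toEll2 m α (-n)‖ ^ 2 ≤ ‖α‖ ^ 2 := by
    have := ell2_sum_le (toEll2 m α) (s.map (Equiv.neg ℤ).toEmbedding)
    rw [Finset.sum_map] at this
    exact this
  refine (norm_sum_le _ _).trans ?_
  simp only [h1]
  refine le_of_sq_le_sq ?_ (by positivity)
  refine (Finset.sum_mul_sq_le_sq_mul_sq _ _ _).trans ?_
  rw [mul_pow]
  exact mul_le_mul h2 (ell2_sum_le _ s) (Finset.sum_nonneg fun _ _ => by positivity) (by positivity)

/-! ### Completeness of the Sobolev spaces -/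

section Complete

variable (m : ℝ) (u : Ell2)

lemma norm_ell2_apply_le (n : ℤ) : ‖u n‖ ≤ ‖u‖ := lp.norm_apply_le_norm (by norm_num) u n

/-- The general term of the pairing with the distribution of Fourier coefficients
`⟨n⟩^{-m} u n`. -/
lemma norm_pairing_term (φ : SmoothCircle) (n : ℤ) :
    ‖coeff n φ * (((bracket n ^ (-m) : ℝ) : ℂ) * u (-n))‖ ≤
      ‖u‖ * (bracket n ^ (-m) * ‖coeff n φ‖) := by
  have h := Real.rpow_nonneg (bracket_pos n).le (-m)
  rw [norm_mul, norm_mul, Complex.norm_real, Real.norm_of_nonneg h]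
  have := norm_ell2_apply_le u (-n)
  calc _ = ‖u (-n)‖ * (bracket n ^ (-m) * ‖coeff n φ‖) := by ring
    _ ≤ _ := by gcongr

lemma summable_pairing (φ : SmoothCircle) :
    Summable fun n => coeff n φ * (((bracket n ^ (-m) : ℝ) : ℂ) * u (-n)) :=
  Summable.of_norm_bounded ((summable_bracket_rpow_mul_coeff (-m) φ).mul_left ‖u‖)
    (norm_pairing_term m u φ)

/-- The distribution of Fourier coefficients `⟨n⟩^{-m} u n`. -/
def ofEll2 : CircleDistribution :=
  ⟨{ toFun := fun φ => ∑' n, coeff n φ * (((bracket n ^ (-m) : ℝ) : ℂ) * u (-n))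
     map_add' := fun φ ψ => by
       rw [← (summable_pairing m u φ).tsum_add (summable_pairing m u ψ)]
       simp [add_mul]
     map_smul' := fun c φ => by
       rw [RingHom.id_apply, smul_eq_mul, ← tsum_mul_left]
       simp [mul_assoc] },
   by
    refine ⟨2 * decayOrder (-m), ‖u‖ * (2 ^ decayOrder (-m) * ∑' n, (bracket n ^ 2)⁻¹),
      fun φ M hM => ?_⟩
    have h1 : ∀ n, ‖coeff n φ * (((bracket n ^ (-m) : ℝ) : ℂ) * u (-n))‖ ≤
        ‖u‖ * (2 ^ decayOrder (-m) * M) * (bracket n ^ 2)⁻¹ := fun n => by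
      refine (norm_pairing_term m u φ n).trans ?_
      rw [mul_assoc]
      exact mul_le_mul_of_nonneg_left (bracket_rpow_mul_coeff_le (-m) hM n) (norm_nonneg _)
    refine (tsum_of_norm_bounded (summable_inv_bracket_sq.hasSum.mul_left _) h1).trans (le_of_eq ?_)
    ring⟩

lemma fourierCoefficient_ofEll2 (n : ℤ) :
    fourierCoefficient (ofEll2 m u) n = ((bracket n ^ (-m) : ℝ) : ℂ) * u n := by
  change ∑' k, coeff k (fourierMode (-n)) * (((bracket k ^ (-m) : ℝ) : ℂ) * u (-k)) = _
  rw [tsum_eq_single (-n)]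
  · simp [coeff_fourierMode, bracket_neg]
  · intro k hk
    simp [coeff_fourierMode, hk]

lemma weightedCoeff_ofEll2 : weightedCoeff m (ofEll2 m u) = u := by
  funext n
  change ((bracket n ^ m : ℝ) : ℂ) * fourierCoefficient (ofEll2 m u) n = _
  rw [fourierCoefficient_ofEll2, ← mul_assoc, ← Complex.ofReal_mul,
    ← Real.rpow_add (bracket_pos n)]
  simp

lemma toEll2_surjective : Function.Surjective (toEll2 m) := fun u =>
  ⟨⟨ofEll2 m u, (memlp_two_iff _).1 (by rw [weightedCoeff_ofEll2]; exact u.2)⟩,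
    Subtype.ext (weightedCoeff_ofEll2 m u)⟩

/-- The isometry of `H^m` and `ℓ²(ℤ)`. -/
def sobolevEquiv : SobolevSpace m ≃ₗᵢ[ℂ] Ell2 where
  toLinearEquiv := LinearEquiv.ofBijective (toEll2 m) ⟨toEll2_injective m, toEll2_surjective m⟩
  norm_map' _ := rfl

instance : CompleteSpace (SobolevSpace m) :=
  (sobolevEquiv m).toIsometryEquiv.completeSpace

/-- The inner product of `H^m`. It is not a global instance. -/
@[reducible] def sobolevInner : InnerProductSpace ℂ (SobolevSpace m) where
  inner α β := inner ℂ (toEll2 m α) (toEll2 m β)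
  norm_sq_eq_re_inner α := norm_sq_eq_re_inner (toEll2 m α)
  conj_inner_symm α β := inner_conj_symm _ _
  add_left α β γ := by rw [map_add, inner_add_left]
  smul_left α β c := by rw [map_smul, inner_smul_left]

end Complete

/-! ### Multiplication, conjugation and differentiation of smooth functions -/

/-- Multiplication by a smooth function. -/
def mulSmooth (a : SmoothCircle) : Module.End ℂ SmoothCircle where
  toFun φ := ⟨fun x => a.1 x * φ.1 x, a.2.1.mul φ.2.1, a.2.2.mul φ.2.2⟩
  map_add' φ ψ := by apply Subtype.ext; funext x; simp [mul_add]
  map_smul' c φ := by apply Subtype.ext; funext x; simp; ring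

/-- Complex conjugation. -/
def conjSmooth (φ : SmoothCircle) : SmoothCircle :=
  ⟨fun x => (starRingEnd ℂ) (φ.1 x), Complex.conjCLE.contDiff.comp φ.2.1,
    fun x => by simp only [φ.2.2 x]⟩

/-- Differentiation. -/
def derivSmooth : Module.End ℂ SmoothCircle where
  toFun φ := ⟨deriv φ.1, deriv_mem φ.2⟩
  map_add' φ ψ := by
    apply Subtype.ext; funext x
    exact deriv_add (φ.2.1.differentiable (by simp) x) (ψ.2.1.differentiable (by simp) x)
  map_smul' c φ := by
    apply Subtype.ext; funext x
    exact deriv_const_smul c (φ.2.1.differentiable (by simp) x)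

lemma hasDerivAt_smooth (φ : SmoothCircle) (x : ℝ) : HasDerivAt φ.1 ((derivSmooth φ).1 x) x :=
  (φ.2.1.differentiable (by simp) x).hasDerivAt

lemma derivSmooth_mulSmooth (a φ : SmoothCircle) :
    derivSmooth (mulSmooth a φ) =
      mulSmooth (derivSmooth a) φ + mulSmooth a (derivSmooth φ) := by
  apply Subtype.ext; funext x
  exact ((hasDerivAt_smooth a x).mul (hasDerivAt_smooth φ x)).deriv

lemma coeff_derivSmooth (n : ℤ) (φ : SmoothCircle) :
    coeff n (derivSmooth φ) = (2 * Real.pi * Complex.I * n) * coeff n φ := by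
  rw [coeff_eq, coeff_eq]; exact fourierCoeff_deriv φ n

lemma norm_coeff_derivSmooth_pow (n : ℤ) (j : ℕ) (φ : SmoothCircle) :
    ‖coeff n ((derivSmooth ^ j) φ)‖ = (2 * Real.pi) ^ j * |(n : ℝ)| ^ j * ‖coeff n φ‖ := by
  have h : coeff n ((derivSmooth ^ j) φ) = (2 * Real.pi * Complex.I * n) ^ j * coeff n φ := by
    induction j with
    | zero => simp
    | succ j ih => rw [pow_succ', Module.End.mul_apply, coeff_derivSmooth, ih]; ring
  rw [h, norm_mul, norm_pow, ← mul_pow]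
  congr 2
  simp [abs_of_pos Real.pi_pos]

lemma norm_sob_zero_apply (φ : SmoothCircle) (n : ℤ) : ‖sob 0 φ n‖ = ‖coeff n φ‖ := by
  rw [norm_sob_apply, Real.rpow_zero, one_mul]

lemma norm_sob_natCast_apply (j : ℕ) (φ : SmoothCircle) (n : ℤ) :
    ‖sob j φ n‖ = bracket n ^ j * ‖coeff n φ‖ := by
  rw [norm_sob_apply, Real.rpow_natCast]

lemma norm_sob_derivSmooth_pow_le (j : ℕ) (φ : SmoothCircle) :
    ‖sob 0 ((derivSmooth ^ j) φ)‖ ≤ (2 * Real.pi) ^ j * ‖sob j φ‖ := by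
  have := Real.pi_pos
  refine ell2_norm_le_mul (by positivity) fun n => ?_
  rw [norm_sob_zero_apply, norm_coeff_derivSmooth_pow, norm_sob_natCast_apply, mul_assoc]
  gcongr
  exact abs_le_bracket n

/-- Used with `a = |n|` and `b = ⟨n⟩`. The leading power keeps the coefficient `1`, which a sharp
`r_m` requires; the error is of lower order. -/
lemma pow_succ_le_of_le_add_one {a b : ℝ} (ha : 0 ≤ a) (hab : a ≤ b) (hb : b ≤ a + 1) (k : ℕ) :
    b ^ (k + 1) ≤ a ^ (k + 1) + (k + 1) * b ^ k := by
  have hb0 : 0 ≤ b := ha.trans hab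
  induction k with
  | zero => simpa using hb
  | succ k ih =>
    have h1 : b ^ (k + 1) * b ≤ (a ^ (k + 1) + (k + 1) * b ^ k) * b := by gcongr
    have h2 : a ^ (k + 1) * b ≤ a ^ (k + 1) * (a + 1) := by gcongr
    have h3 : a ^ (k + 1) ≤ b ^ (k + 1) := by gcongr
    push_cast
    have e1 : b ^ (k + 1 + 1) = b ^ (k + 1) * b := pow_succ _ _
    have e2 : a ^ (k + 1 + 1) = a ^ (k + 1) * a := pow_succ _ _
    have e3 : b ^ (k + 1) = b ^ k * b := pow_succ _ _
    rw [e1, e2]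
    nlinarith

/-- The constant in front of the top derivative is the inverse of the one in
`norm_sob_derivSmooth_pow_le`, so passing to derivatives and back costs only a lower order term. -/
lemma norm_sob_succ_le (k : ℕ) (φ : SmoothCircle) :
    ‖sob (k + 1 : ℕ) φ‖ ≤ ((2 * Real.pi) ^ (k + 1))⁻¹ * ‖sob 0 ((derivSmooth ^ (k + 1)) φ)‖ +
      (k + 1) * ‖sob k φ‖ := by
  have hpi := Real.pi_pos
  set c : ℝ := ((2 * Real.pi) ^ (k + 1))⁻¹ with hc
  have h1 : ‖sob (k + 1 : ℕ) φ‖ ≤ ‖(c : ℂ) • sob 0 ((derivSmooth ^ (k + 1)) φ)‖ +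
      (k + 1) * ‖sob k φ‖ := by
    refine ell2_norm_le_add_mul (by positivity) fun n => ?_
    have e : ‖((c : ℂ) • sob 0 ((derivSmooth ^ (k + 1)) φ)) n‖ =
        |(n : ℝ)| ^ (k + 1) * ‖coeff n φ‖ := by
      change ‖(c : ℂ) * sob 0 ((derivSmooth ^ (k + 1)) φ) n‖ = _
      rw [norm_mul, norm_sob_zero_apply, norm_coeff_derivSmooth_pow, Complex.norm_real,
        Real.norm_of_nonneg (by positivity), hc]
      field_simp
    rw [e, norm_sob_natCast_apply, norm_sob_natCast_apply, ← mul_assoc, ← add_mul]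
    gcongr
    exact pow_succ_le_of_le_add_one (abs_nonneg _) (abs_le_bracket n) (bracket_le_abs_add_one n) k
  refine h1.trans (le_of_eq ?_)
  rw [norm_smul, Complex.norm_real, Real.norm_of_nonneg (by positivity)]

/-! ### The `L²` norm -/

lemma coeff_conj (n : ℤ) (φ : SmoothCircle) :
    (ofSmooth (conjSmooth φ)).1 (fourierMode n) = (starRingEnd ℂ) (coeff n φ) := by
  change ∫ x in (0 : ℝ)..1, (starRingEnd ℂ) (φ.1 x) * (fourierMode n).1 x =
    (starRingEnd ℂ) (∫ x in (0 : ℝ)..1, (fourierMode (-n)).1 x * φ.1 x)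
  rw [← intervalIntegral.intervalIntegral_conj]
  congr 1; funext x
  rw [map_mul, mul_comm]
  congr 1
  simp only [fourierMode]
  rw [← Complex.exp_conj]
  congr 1
  have h2 : (starRingEnd ℂ) 2 = 2 := Complex.conj_ofReal 2
  simp [h2]

-- Parseval: pairing the conjugate of `φ` with the Fourier partial sums of `φ` gives the partial
-- sums of `∑ |φ̂(n)|²`, and in the limit the integral.
open Filter Topology in
lemma norm_sob_zero_sq (φ : SmoothCircle) : ‖sob 0 φ‖ ^ 2 = ∫ x in (0 : ℝ)..1, ‖φ.1 x‖ ^ 2 := by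
  have h1 := tendsto_apply_fourierPartialSum (ofSmooth (conjSmooth φ)) φ
  have e1 : ∀ s, (ofSmooth (conjSmooth φ)).1 (fourierPartialSum φ s) =
      ((∑ n ∈ s, ‖sob 0 φ n‖ ^ 2 : ℝ) : ℂ) := fun s => by
    rw [fourierPartialSum, map_sum, Complex.ofReal_sum]
    refine Finset.sum_congr rfl fun n _ => ?_
    rw [map_smul, coeff_conj, ← coeff_eq, norm_sob_zero_apply, smul_eq_mul, Complex.mul_conj,
      Complex.normSq_eq_norm_sq]
  simp only [e1] at h1
  have h2 : Tendsto (fun s : Finset ℤ => ((∑ n ∈ s, ‖sob 0 φ n‖ ^ 2 : ℝ) : ℂ)) atTop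
      (𝓝 ((‖sob 0 φ‖ ^ 2 : ℝ) : ℂ)) := by
    rw [ell2_norm_sq]
    exact (Complex.continuous_ofReal.tendsto _).comp (ell2_summable (sob 0 φ)).hasSum
  have h3 := tendsto_nhds_unique h2 h1
  have e2 : (ofSmooth (conjSmooth φ)).1 φ = ((∫ x in (0 : ℝ)..1, ‖φ.1 x‖ ^ 2 : ℝ) : ℂ) := by
    rw [← intervalIntegral.integral_ofReal]
    change ∫ x in (0 : ℝ)..1, (starRingEnd ℂ) (φ.1 x) * φ.1 x = _
    congr 1; funext x
    rw [mul_comm, Complex.mul_conj, Complex.normSq_eq_norm_sq]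
  rw [e2] at h3
  exact_mod_cast h3

lemma norm_sob_zero_mulSmooth_le {a : SmoothCircle} {c : ℝ} (ha : ∀ x, ‖a.1 x‖ ≤ c)
    (φ : SmoothCircle) : ‖sob 0 (mulSmooth a φ)‖ ≤ c * ‖sob 0 φ‖ := by
  have hc : 0 ≤ c := (norm_nonneg _).trans (ha 0)
  refine le_of_sq_le_sq ?_ (by positivity)
  rw [mul_pow, norm_sob_zero_sq, norm_sob_zero_sq, ← intervalIntegral.integral_const_mul]
  refine intervalIntegral.integral_mono_on zero_le_one
    (((mulSmooth a φ).2.1.continuous.norm.pow 2).intervalIntegrable _ _)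
    ((continuous_const.mul (φ.2.1.continuous.norm.pow 2)).intervalIntegrable _ _) fun x _ => ?_
  change ‖a.1 x * φ.1 x‖ ^ 2 ≤ _
  rw [norm_mul, mul_pow]
  gcongr
  exact ha x

lemma exists_norm_sob_zero_mulSmooth_le (a : SmoothCircle) :
    ∃ C, 0 ≤ C ∧ ∀ φ, ‖sob 0 (mulSmooth a φ)‖ ≤ C * ‖sob 0 φ‖ := by
  obtain ⟨B, h1, hB⟩ := ExpandingData.bounded_of_periodic one_ne_zero a.2.1.continuous a.2.2
  exact ⟨B, zero_le_one.trans h1, norm_sob_zero_mulSmooth_le hB⟩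

/-! ### Lasota–Yorke inequalities for the transposed operator -/

namespace ExpandingData

variable (S : ExpandingData)

lemma Emin_pos : 0 < S.Emin := zero_lt_one.trans S.one_lt_Emin

/-- The smooth function `1 / E'`. -/
def invJac : SmoothCircle := ⟨S.jacWeight 0, S.contDiff_jacWeight 0, S.periodic_jacWeight 0⟩

/-- The smooth function `e^{iντ}`. -/
def weightSmooth (ν : ℝ) : SmoothCircle := ⟨S.weight ν, S.contDiff_weight ν, S.periodic_weight ν⟩

lemma jacWeight_zero (x : ℝ) : S.jacWeight 0 x = ((deriv S.E x)⁻¹ : ℝ) := by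
  simp [jacWeight, weight]

lemma norm_weight (ν x : ℝ) : ‖S.weight ν x‖ = 1 := by
  rw [weight, show Complex.I * ν * S.τ x = ((ν * S.τ x : ℝ) : ℂ) * Complex.I by push_cast; ring]
  exact Complex.norm_exp_ofReal_mul_I _

lemma norm_jacWeight_zero_le (x : ℝ) : ‖S.jacWeight 0 x‖ ≤ S.Emin⁻¹ := by
  rw [jacWeight_zero, Complex.norm_real, Real.norm_of_nonneg (inv_nonneg.2 (S.deriv_E_pos x).le)]
  exact inv_anti₀ S.Emin_pos (S.Emin_le x)

lemma transpose_apply (ν : ℝ) (φ : SmoothCircle) (y : ℝ) : (S.transpose ν φ).1 y =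
    ∑ ε ∈ Finset.range S.k, S.jacWeight ν (S.branch ε y) * φ.1 (S.branch ε y) := rfl

/-- Moving the phase into the argument means that derivatives need to be commuted only with the
operator for `ν = 0`. -/
lemma transpose_eq (ν : ℝ) (φ : SmoothCircle) :
    S.transpose ν φ = S.transpose 0 (mulSmooth (S.weightSmooth ν) φ) := by
  apply Subtype.ext; funext y
  rw [transpose_apply, transpose_apply]
  refine Finset.sum_congr rfl fun ε _ => ?_
  rw [jacWeight_zero]
  simp only [mulSmooth, weightSmooth, LinearMap.coe_mk, AddHom.coe_mk, jacWeight]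
  push_cast
  ring

lemma hasDerivAt_branch (ε : ℕ) (y : ℝ) :
    HasDerivAt (S.branch ε) (deriv S.E (S.branch ε y))⁻¹ y := by
  have h1 : HasDerivAt (S.branch ε) (deriv (S.branch ε) y) y :=
    ((S.contDiff_branch ε).differentiable (by simp) y).hasDerivAt
  have h2 : HasDerivAt S.E (deriv S.E (S.branch ε y)) (S.branch ε y) :=
    (S.contDiff_E.differentiable (by simp) _).hasDerivAt
  have h3 := h2.comp y h1
  have h4 : S.E ∘ S.branch ε = fun y : ℝ => y + (ε : ℝ) := funext (S.E_branch ε)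
  rw [h4] at h3
  have h5 := h3.unique ((hasDerivAt_id y).add_const (ε : ℝ))
  have h6 := (S.deriv_E_pos (S.branch ε y)).ne'
  rwa [eq_inv_of_mul_eq_one_right h5] at h1

/-- The operator is a sum of `(φ / E') ∘ branch`; the chain rule produces another `1 / E'` at the
branch point, which is again the weight of the operator. -/
lemma derivSmooth_transpose_zero (φ : SmoothCircle) :
    derivSmooth (S.transpose 0 φ) = S.transpose 0 (derivSmooth (mulSmooth S.invJac φ)) := by
  apply Subtype.ext; funext y
  have h : HasDerivAt (fun y => ∑ ε ∈ Finset.range S.k, (mulSmooth S.invJac φ).1 (S.branch ε y))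
      (∑ ε ∈ Finset.range S.k, (deriv S.E (S.branch ε y))⁻¹ •
        (derivSmooth (mulSmooth S.invJac φ)).1 (S.branch ε y)) y := by
    refine HasDerivAt.fun_sum fun ε _ => ?_
    exact (hasDerivAt_smooth (mulSmooth S.invJac φ) (S.branch ε y)).scomp y
      (S.hasDerivAt_branch ε y)
  refine h.deriv.trans ?_
  refine Finset.sum_congr rfl fun ε _ => ?_
  rw [jacWeight_zero, Complex.real_smul]

lemma derivSmooth_pow_transpose_zero (n : ℕ) (φ : SmoothCircle) :
    (derivSmooth ^ n) (S.transpose 0 φ) =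
      S.transpose 0 (((derivSmooth * mulSmooth S.invJac) ^ n) φ) := by
  induction n with
  | zero => rfl
  | succ n ih =>
    rw [pow_succ', Module.End.mul_apply, ih, derivSmooth_transpose_zero, pow_succ']
    rfl

/-- Change of variables: `∫ L h = ∫ h` for `L h (y) = ∑ h(x) / E'(x)`. -/
lemma integral_transpose_zero (h : SmoothCircle) :
    ∫ y in (0 : ℝ)..1, (S.transpose 0 h).1 y = ∫ x in (0 : ℝ)..1, h.1 x := by
  -- Test the duality formula on the constant function `1`, which is fixed when `ν = 0`.
  have h1 := congrArg (fun α : CircleDistribution => α.1 h) (S.transfer_ofSmooth 0 (fourierMode 0))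
  have h2 : ∀ x, (fourierMode 0).1 x = 1 := fun x => by simp [fourierMode]
  have h3 : ∀ x, (S.transferSmooth 0 (fourierMode 0)).1 x = 1 := fun x => by
    simp [transferSmooth, h2, weight]
  change ∫ y in (0 : ℝ)..1, (fourierMode 0).1 y * (S.transpose 0 h).1 y =
    ∫ x in (0 : ℝ)..1, (S.transferSmooth 0 (fourierMode 0)).1 x * h.1 x at h1
  simpa only [h2, h3, one_mul] using h1

/-- Cauchy–Schwarz over the branches gives the factor `k`. The square contains `1 / E'` twice: one
is the Jacobian of the change of variables, the other is at most `1 / E_min`. -/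
lemma norm_sob_zero_transpose_zero_le (φ : SmoothCircle) :
    ‖sob 0 (S.transpose 0 φ)‖ ≤ Real.sqrt (S.k / S.Emin) * ‖sob 0 φ‖ := by
  have hk := S.k_pos
  have hE := S.Emin_pos
  refine le_of_sq_le_sq ?_ (by positivity)
  rw [mul_pow, Real.sq_sqrt (by positivity), norm_sob_zero_sq, norm_sob_zero_sq]
  -- `h = |φ|² / E'`, whose image under the operator is the sum of the squared branch terms.
  set h : SmoothCircle := mulSmooth S.invJac (mulSmooth (conjSmooth φ) φ) with hh
  have hx : ∀ x, h.1 x = (((deriv S.E x)⁻¹ * ‖φ.1 x‖ ^ 2 : ℝ) : ℂ) := fun x => by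
    change S.jacWeight 0 x * ((starRingEnd ℂ) (φ.1 x) * φ.1 x) = _
    rw [jacWeight_zero, mul_comm ((starRingEnd ℂ) _), Complex.mul_conj, Complex.normSq_eq_norm_sq]
    push_cast; ring
  have hc : Continuous fun x => (deriv S.E x)⁻¹ * ‖φ.1 x‖ ^ 2 :=
    ((contDiff_infty_iff_deriv.1 S.contDiff_E).2.continuous.inv₀
      fun x => (S.deriv_E_pos x).ne').mul (φ.2.1.continuous.norm.pow 2)
  have hLx : ∀ y, ((S.transpose 0 h).1 y) = ((∑ ε ∈ Finset.range S.k,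
      ((deriv S.E (S.branch ε y))⁻¹ * ‖φ.1 (S.branch ε y)‖) ^ 2 : ℝ) : ℂ) := fun y => by
    rw [Complex.ofReal_sum, transpose_apply]
    refine Finset.sum_congr rfl fun ε _ => ?_
    rw [jacWeight_zero, hx]
    push_cast; ring
  have h1 := S.integral_transpose_zero h
  simp only [hLx, hx] at h1
  rw [intervalIntegral.integral_ofReal, intervalIntegral.integral_ofReal] at h1
  have h1 := Complex.ofReal_injective h1
  have hc' : Continuous fun y => ∑ ε ∈ Finset.range S.k,
      ((deriv S.E (S.branch ε y))⁻¹ * ‖φ.1 (S.branch ε y)‖) ^ 2 := by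
    refine continuous_finsetSum _ fun ε _ => ?_
    have hb := (S.contDiff_branch ε).continuous
    exact ((((contDiff_infty_iff_deriv.1 S.contDiff_E).2.continuous.comp hb).inv₀
      fun x => (S.deriv_E_pos _).ne').mul (φ.2.1.continuous.comp hb).norm).pow 2
  calc ∫ y in (0 : ℝ)..1, ‖(S.transpose 0 φ).1 y‖ ^ 2
      ≤ ∫ y in (0 : ℝ)..1, (S.k : ℝ) * ∑ ε ∈ Finset.range S.k,
        ((deriv S.E (S.branch ε y))⁻¹ * ‖φ.1 (S.branch ε y)‖) ^ 2 := by
        refine intervalIntegral.integral_mono_on zero_le_one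
          (((S.transpose 0 φ).2.1.continuous.norm.pow 2).intervalIntegrable _ _)
          ((continuous_const.mul hc').intervalIntegrable _ _) fun y _ => ?_
        have h2 : ‖(S.transpose 0 φ).1 y‖ ≤ ∑ ε ∈ Finset.range S.k,
            (deriv S.E (S.branch ε y))⁻¹ * ‖φ.1 (S.branch ε y)‖ := by
          rw [transpose_apply]
          refine norm_sum_le_of_le _ fun ε _ => le_of_eq ?_
          rw [norm_mul, jacWeight_zero, Complex.norm_real,
            Real.norm_of_nonneg (inv_nonneg.2 (S.deriv_E_pos _).le)]
        refine (pow_le_pow_left₀ (norm_nonneg _) h2 2).trans ?_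
        simpa using sq_sum_le_card_mul_sum_sq (s := Finset.range S.k)
          (f := fun ε => (deriv S.E (S.branch ε y))⁻¹ * ‖φ.1 (S.branch ε y)‖)
    _ = (S.k : ℝ) * ∫ x in (0 : ℝ)..1, (deriv S.E x)⁻¹ * ‖φ.1 x‖ ^ 2 := by
        rw [intervalIntegral.integral_const_mul, h1]
    _ ≤ (S.k : ℝ) * ∫ x in (0 : ℝ)..1, S.Emin⁻¹ * ‖φ.1 x‖ ^ 2 := by
        gcongr
        refine intervalIntegral.integral_mono_on zero_le_one (hc.intervalIntegrable _ _)
          ((continuous_const.mul (φ.2.1.continuous.norm.pow 2)).intervalIntegrable _ _)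
          fun x _ => ?_
        gcongr
        exact S.Emin_le x
    _ = _ := by rw [intervalIntegral.integral_const_mul]; ring

/-- Leading part of the operator `(D ∘ 1/E')ⁿ ∘ a`. -/
lemma exists_norm_pow_sub_leading_le (n : ℕ) : ∀ a : SmoothCircle, ∃ C, 0 ≤ C ∧ ∀ φ,
    ‖sob 0 (((derivSmooth * mulSmooth S.invJac) ^ n) (mulSmooth a φ)) -
      sob 0 (mulSmooth ((mulSmooth S.invJac ^ n) a) ((derivSmooth ^ n) φ))‖ ≤
      C * ∑ i ∈ Finset.range n, ‖sob 0 ((derivSmooth ^ i) φ)‖ := by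
  induction n with
  | zero => exact fun a => ⟨0, le_rfl, fun φ => by simp⟩
  | succ n ih =>
    intro a
    set b := mulSmooth S.invJac a with hb
    obtain ⟨C₁, hC₁, h₁⟩ := ih b
    obtain ⟨C₂, hC₂, h₂⟩ := ih (derivSmooth b)
    obtain ⟨C₃, hC₃, h₃⟩ := exists_norm_sob_zero_mulSmooth_le
      ((mulSmooth S.invJac ^ n) (derivSmooth b))
    refine ⟨C₁ + C₂ + C₃, by positivity, fun φ => ?_⟩
    have e1 : ((derivSmooth * mulSmooth S.invJac) ^ (n + 1)) (mulSmooth a φ) =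
        ((derivSmooth * mulSmooth S.invJac) ^ n) (mulSmooth (derivSmooth b) φ) +
        ((derivSmooth * mulSmooth S.invJac) ^ n) (mulSmooth b (derivSmooth φ)) := by
      rw [pow_succ, Module.End.mul_apply, ← map_add, ← derivSmooth_mulSmooth,
        Module.End.mul_apply]
      congr 2
      apply Subtype.ext; funext x
      simp [mulSmooth, hb, mul_assoc]
    have e2 : (mulSmooth S.invJac ^ (n + 1)) a = (mulSmooth S.invJac ^ n) b := by
      rw [pow_succ, Module.End.mul_apply]
    have e3 : ∀ i, (derivSmooth ^ (i + 1)) φ = (derivSmooth ^ i) (derivSmooth φ) := fun i => by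
      rw [pow_succ, Module.End.mul_apply]
    have g1 := h₁ (derivSmooth φ)
    have g2 := h₂ φ
    have g3 := h₃ ((derivSmooth ^ n) φ)
    set s := ∑ i ∈ Finset.range (n + 1), ‖sob 0 ((derivSmooth ^ i) φ)‖ with hs
    have s1 : ∑ i ∈ Finset.range n, ‖sob 0 ((derivSmooth ^ i) (derivSmooth φ))‖ ≤ s := by
      simp only [← e3]
      rw [hs, Finset.sum_range_succ']
      linarith [norm_nonneg (sob 0 ((derivSmooth ^ 0) φ))]
    have s2 : ∑ i ∈ Finset.range n, ‖sob 0 ((derivSmooth ^ i) φ)‖ ≤ s := by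
      rw [hs, Finset.sum_range_succ]
      linarith [norm_nonneg (sob 0 ((derivSmooth ^ n) φ))]
    have s3 : ‖sob 0 ((derivSmooth ^ n) φ)‖ ≤ s :=
      Finset.single_le_sum (f := fun i => ‖sob 0 ((derivSmooth ^ i) φ)‖)
        (fun _ _ => norm_nonneg _) (Finset.self_mem_range_succ n)
    rw [e1, e2, e3, map_add]
    set A := sob 0 (((derivSmooth * mulSmooth S.invJac) ^ n) (mulSmooth (derivSmooth b) φ))
    set B := sob 0 (((derivSmooth * mulSmooth S.invJac) ^ n) (mulSmooth b (derivSmooth φ)))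
    set L₁ := sob 0 (mulSmooth ((mulSmooth S.invJac ^ n) b) ((derivSmooth ^ n) (derivSmooth φ)))
    set L₂ := sob 0 (mulSmooth ((mulSmooth S.invJac ^ n) (derivSmooth b)) ((derivSmooth ^ n) φ))
    -- By Leibniz, `D (b φ) = (D b) φ + b (D φ)`. The second term carries the leading part and is
    -- compared with `L₁`; the first has only `n` derivatives on `φ`, so even its leading part `L₂`
    -- is of lower order.
    have e4 : A + B - L₁ = (B - L₁) + (A - L₂) + L₂ := by abel
    rw [e4]
    refine (norm_add₃_le).trans ?_
    rw [add_mul, add_mul]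
    gcongr
    · exact g1.trans (by gcongr)
    · exact g2.trans (by gcongr)
    · exact g3.trans (by gcongr)

lemma norm_invJac_pow_weight_le (ν : ℝ) (n : ℕ) (x : ℝ) :
    ‖((mulSmooth S.invJac ^ n) (S.weightSmooth ν)).1 x‖ ≤ (S.Emin ^ n)⁻¹ := by
  induction n with
  | zero => simpa using! (S.norm_weight ν x).le
  | succ n ih =>
    rw [pow_succ', Module.End.mul_apply]
    change ‖S.jacWeight 0 x * ((mulSmooth S.invJac ^ n) (S.weightSmooth ν)).1 x‖ ≤ _
    rw [norm_mul, pow_succ', mul_inv]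
    have := S.norm_jacWeight_zero_le x
    have := S.Emin_pos
    gcongr

/-- The coefficient of `Dⁿ φ` after commutation is `e^{iντ} / E'ⁿ`, of modulus at most `E_min⁻ⁿ`;
the `L²` bound of the operator gives the other factor. -/
lemma exists_norm_deriv_transpose_le (ν : ℝ) (n : ℕ) : ∃ C, 0 ≤ C ∧ ∀ φ,
    ‖sob 0 ((derivSmooth ^ n) (S.transpose ν φ))‖ ≤
      Real.sqrt (S.k / S.Emin) * (S.Emin ^ n)⁻¹ * ‖sob 0 ((derivSmooth ^ n) φ)‖ +
      C * ∑ i ∈ Finset.range n, ‖sob 0 ((derivSmooth ^ i) φ)‖ := by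
  obtain ⟨C, hC, h⟩ := S.exists_norm_pow_sub_leading_le n (S.weightSmooth ν)
  refine ⟨Real.sqrt (S.k / S.Emin) * C, by positivity, fun φ => ?_⟩
  rw [transpose_eq, derivSmooth_pow_transpose_zero]
  refine (S.norm_sob_zero_transpose_zero_le _).trans ?_
  rw [mul_assoc, mul_assoc, ← mul_add]
  gcongr
  have h1 := h φ
  have h2 := norm_sob_zero_mulSmooth_le (S.norm_invJac_pow_weight_le ν n) ((derivSmooth ^ n) φ)
  have h3 := norm_le_norm_add_norm_sub'
    (sob 0 (((derivSmooth * mulSmooth S.invJac) ^ n) (mulSmooth (S.weightSmooth ν) φ)))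
    (sob 0 (mulSmooth ((mulSmooth S.invJac ^ n) (S.weightSmooth ν)) ((derivSmooth ^ n) φ)))
  linarith

lemma norm_sob_zero_transpose_le (ν : ℝ) (φ : SmoothCircle) :
    ‖sob 0 (S.transpose ν φ)‖ ≤ Real.sqrt (S.k / S.Emin) * ‖sob 0 φ‖ := by
  rw [transpose_eq]
  refine (S.norm_sob_zero_transpose_zero_le _).trans ?_
  gcongr
  simpa using norm_sob_zero_mulSmooth_le (a := S.weightSmooth ν)
    (fun x => (S.norm_weight ν x).le) φ

/-- The transposed operator on `H^{n+1}`, up to a remainder bounded by the `H^n` norm. -/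
lemma exists_norm_sob_succ_transpose_le (ν : ℝ) (n : ℕ)
    (hn : ∃ C, 0 ≤ C ∧ ∀ φ, ‖sob n (S.transpose ν φ)‖ ≤ C * ‖sob n φ‖) :
    ∃ C, 0 ≤ C ∧ ∀ φ, ‖sob (n + 1 : ℕ) (S.transpose ν φ)‖ ≤
      Real.sqrt (S.k / S.Emin) * (S.Emin ^ (n + 1))⁻¹ * ‖sob (n + 1 : ℕ) φ‖ + C * ‖sob n φ‖ := by
  obtain ⟨C₁, hC₁, h₁⟩ := hn
  obtain ⟨C₂, hC₂, h₂⟩ := S.exists_norm_deriv_transpose_le ν (n + 1)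
  have hpi := Real.pi_pos
  have hE := S.Emin_pos
  set A : ℝ := ∑ i ∈ Finset.range (n + 1), (2 * Real.pi) ^ i with hA
  have hA0 : 0 ≤ A := Finset.sum_nonneg fun i _ => by positivity
  refine ⟨((2 * Real.pi) ^ (n + 1))⁻¹ * (C₂ * A) + (n + 1) * C₁, by positivity, fun φ => ?_⟩
  have hs : ∑ i ∈ Finset.range (n + 1), ‖sob 0 ((derivSmooth ^ i) φ)‖ ≤ A * ‖sob n φ‖ := by
    rw [hA, Finset.sum_mul]
    refine Finset.sum_le_sum fun i hi => (norm_sob_derivSmooth_pow_le i φ).trans ?_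
    gcongr
    exact norm_sob_mono (by exact_mod_cast Nat.lt_succ_iff.1 (Finset.mem_range.1 hi)) φ
  set q : ℝ := Real.sqrt (S.k / S.Emin) * (S.Emin ^ (n + 1))⁻¹ with hq
  have hq0 : 0 ≤ q := by positivity
  -- The powers of `2π` cancel exactly, leaving the leading constant `q`; all other terms are
  -- bounded by the `H^n` norm.
  calc ‖sob (n + 1 : ℕ) (S.transpose ν φ)‖
      ≤ ((2 * Real.pi) ^ (n + 1))⁻¹ * ‖sob 0 ((derivSmooth ^ (n + 1)) (S.transpose ν φ))‖ +
        (n + 1) * ‖sob n (S.transpose ν φ)‖ := norm_sob_succ_le n _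
    _ ≤ ((2 * Real.pi) ^ (n + 1))⁻¹ * (q * ((2 * Real.pi) ^ (n + 1) * ‖sob (n + 1 : ℕ) φ‖) +
        C₂ * (A * ‖sob n φ‖)) + (n + 1) * (C₁ * ‖sob n φ‖) := by
        gcongr
        · refine (h₂ φ).trans ?_
          gcongr
          exact norm_sob_derivSmooth_pow_le (n + 1) φ
        · exact h₁ φ
    _ = _ := by field_simp; ring

lemma exists_norm_sob_transpose_le (ν : ℝ) (n : ℕ) :
    ∃ C, 0 ≤ C ∧ ∀ φ, ‖sob n (S.transpose ν φ)‖ ≤ C * ‖sob n φ‖ := by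
  induction n with
  | zero =>
    refine ⟨Real.sqrt (S.k / S.Emin), by positivity, fun φ => ?_⟩
    simpa using S.norm_sob_zero_transpose_le ν φ
  | succ n ih =>
    obtain ⟨C, hC, h⟩ := S.exists_norm_sob_succ_transpose_le ν n ih
    have hE := S.Emin_pos
    refine ⟨Real.sqrt (S.k / S.Emin) * (S.Emin ^ (n + 1))⁻¹ + C, by positivity, fun φ => ?_⟩
    rw [add_mul]
    refine (h φ).trans ?_
    gcongr
    exact norm_sob_mono (by exact_mod_cast Nat.le_succ n) φ

end ExpandingData

/-! ### Interpolation between Sobolev norms on trigonometric polynomials -/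

/-- The trigonometric polynomial `∑ η ∈ B, u η e^{2πiηx}`. -/
def trig (B : Finset ℤ) (u : ℤ → ℂ) : SmoothCircle := ∑ η ∈ B, u η • fourierMode η

lemma coeff_trig (B : Finset ℤ) (u : ℤ → ℂ) (n : ℤ) :
    coeff n (trig B u) = if n ∈ B then u n else 0 := by
  simp [trig, coeff_fourierMode]

lemma norm_sob_trig_sq (s : ℝ) (B : Finset ℤ) (u : ℤ → ℂ) :
    ‖sob s (trig B u)‖ ^ 2 = ∑ η ∈ B, (bracket η ^ s * ‖u η‖) ^ 2 := by
  rw [ell2_norm_sq, tsum_eq_sum (s := B)]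
  · refine Finset.sum_congr rfl fun η hη => ?_
    rw [norm_sob_apply, coeff_trig, if_pos hη]
  · intro η hη
    rw [norm_sob_apply, coeff_trig, if_neg hη]
    simp

lemma norm_bracket_cpow (n : ℤ) (z : ℂ) : ‖(bracket n : ℂ) ^ z‖ = bracket n ^ z.re :=
  Complex.norm_cpow_eq_rpow_re_of_pos (bracket_pos n) z

/-- The value does not depend on `z`: this is the normalisation of the analytic family used for
interpolation. -/
lemma norm_sob_trig_cpow (B : Finset ℤ) (u : ℤ → ℂ) (z : ℂ) :
    ‖sob z.re (trig B fun η => (bracket η : ℂ) ^ (-z) * u η)‖ = Real.sqrt (∑ η ∈ B, ‖u η‖ ^ 2) := by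
  rw [eq_comm, Real.sqrt_eq_iff_mul_self_eq (Finset.sum_nonneg fun _ _ => by positivity)
    (norm_nonneg _), ← sq, norm_sob_trig_sq]
  refine Finset.sum_congr rfl fun η _ => ?_
  rw [norm_mul, norm_bracket_cpow, ← mul_assoc, ← Real.rpow_add (bracket_pos η)]
  simp

open Complex.HadamardThreeLines in
/-- A linear operator which is bounded for the `L²` norm and the `H^t` norm on the trigonometric
polynomials of frequencies in `B` is bounded for the intermediate norms. -/
lemma norm_sob_interpolate (G : SmoothCircle →ₗ[ℂ] SmoothCircle) (B : Finset ℤ) {t s C₀ C₁ : ℝ}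
    (hs : 0 ≤ s) (hst : s ≤ t) (ht : 0 < t) (hC₀ : 0 ≤ C₀) (hC₁ : 0 ≤ C₁)
    (h₀ : ∀ u, ‖sob 0 (G (trig B u))‖ ≤ C₀ * ‖sob 0 (trig B u)‖)
    (h₁ : ∀ u, ‖sob t (G (trig B u))‖ ≤ C₁ * ‖sob t (trig B u)‖) (u : ℤ → ℂ) :
    ‖sob s (G (trig B u))‖ ≤ C₀ ^ (1 - s / t) * C₁ ^ (s / t) * ‖sob s (trig B u)‖ := by
  set θ := s / t with hθ
  have hθ0 : 0 ≤ θ := div_nonneg hs ht.le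
  have hθ1 : θ ≤ 1 := (div_le_one ht).2 hst
  have hK : 0 ≤ C₀ ^ (1 - θ) * C₁ ^ θ := by positivity
  -- the bilinear form
  have key : ∀ (A : Finset ℤ) (v w : ℤ → ℂ),
      ‖∑ ξ ∈ A, v ξ * ((bracket ξ : ℂ) ^ (s : ℂ) *
        coeff ξ (G (trig B fun η => (bracket η : ℂ) ^ (-(s : ℂ)) * w η)))‖ ≤
      C₀ ^ (1 - θ) * C₁ ^ θ *
        (Real.sqrt (∑ ξ ∈ A, ‖v ξ‖ ^ 2) * Real.sqrt (∑ η ∈ B, ‖w η‖ ^ 2)) := by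
    intro A v w
    set q := Real.sqrt (∑ ξ ∈ A, ‖v ξ‖ ^ 2) * Real.sqrt (∑ η ∈ B, ‖w η‖ ^ 2) with hq
    have hq0 : 0 ≤ q := by positivity
    set f : ℂ → ℂ := fun z => ∑ ξ ∈ A, v ξ * ((bracket ξ : ℂ) ^ z *
        coeff ξ (G (trig B fun η => (bracket η : ℂ) ^ (-z) * w η))) with hf
    have hfe : ∀ z, f z = ∑ ξ ∈ A, v ξ * ((bracket ξ : ℂ) ^ z *
        ∑ η ∈ B, (bracket η : ℂ) ^ (-z) * w η * coeff ξ (G (fourierMode η))) := fun z => by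
      simp [hf, trig]
    have hb0 : ∀ n, (bracket n : ℂ) ≠ 0 := fun n => by exact_mod_cast (bracket_pos n).ne'
    have hdiff : Differentiable ℂ f := by
      rw [funext hfe]
      refine Differentiable.fun_sum fun ξ _ => (differentiable_const _).mul
        (Differentiable.mul ?_ (Differentiable.fun_sum fun η _ => Differentiable.mul
          (Differentiable.mul ?_ (differentiable_const _)) (differentiable_const _)))
      · exact differentiable_id.const_cpow (Or.inl (hb0 ξ))
      · exact differentiable_neg.const_cpow (Or.inl (hb0 η))
    -- Imaginary powers of the bracket are unimodular, so the `H^{Re z}` bound and Cauchy–Schwarz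
    -- control `f` on the whole vertical line.
    have hline : ∀ (C : ℝ) (z : ℂ), 0 ≤ C →
        (∀ u, ‖sob z.re (G (trig B u))‖ ≤ C * ‖sob z.re (trig B u)‖) → ‖f z‖ ≤ C * q := by
      intro C z hC h
      have h1 := h fun η => (bracket η : ℂ) ^ (-z) * w η
      rw [norm_sob_trig_cpow] at h1
      set ψ := G (trig B fun η => (bracket η : ℂ) ^ (-z) * w η)
      have h2 : ‖f z‖ ≤ ∑ ξ ∈ A, ‖v ξ‖ * ‖sob z.re ψ ξ‖ := by
        refine norm_sum_le_of_le _ fun ξ _ => le_of_eq ?_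
        rw [norm_mul, norm_mul, norm_bracket_cpow, norm_sob_apply]
      refine h2.trans ?_
      have h3 : ∑ ξ ∈ A, ‖v ξ‖ * ‖sob z.re ψ ξ‖ ≤
          Real.sqrt (∑ ξ ∈ A, ‖v ξ‖ ^ 2) * ‖sob z.re ψ‖ := by
        refine le_of_sq_le_sq ?_ (by positivity)
        rw [mul_pow, Real.sq_sqrt (Finset.sum_nonneg fun _ _ => by positivity)]
        refine (Finset.sum_mul_sq_le_sq_mul_sq _ _ _).trans ?_
        gcongr
        exact ell2_sum_le _ A
      refine h3.trans ?_
      calc _ ≤ Real.sqrt (∑ ξ ∈ A, ‖v ξ‖ ^ 2) * (C * Real.sqrt (∑ η ∈ B, ‖w η‖ ^ 2)) := by gcongr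
        _ = _ := by rw [hq]; ring
    have hbdd : BddAbove ((norm ∘ f) '' verticalClosedStrip 0 t) := by
      refine ⟨∑ ξ ∈ A, ‖v ξ‖ * (bracket ξ ^ t *
        ∑ η ∈ B, 1 * ‖w η‖ * ‖coeff ξ (G (fourierMode η))‖), ?_⟩
      rintro _ ⟨z, hz, rfl⟩
      have hz : 0 ≤ z.re ∧ z.re ≤ t := hz
      change ‖f z‖ ≤ _
      rw [hfe]
      refine norm_sum_le_of_le _ fun ξ _ => ?_
      rw [norm_mul, norm_mul, norm_bracket_cpow]
      gcongr
      · exact Real.rpow_nonneg (bracket_pos ξ).le t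
      · exact one_le_bracket ξ
      · exact hz.2
      · refine norm_sum_le_of_le _ fun η _ => ?_
        rw [norm_mul, norm_mul, norm_bracket_cpow]
        gcongr
        refine Real.rpow_le_one_of_one_le_of_nonpos (one_le_bracket η) ?_
        simpa using hz.1
    -- Three lines theorem on `0 ≤ Re z ≤ t`, evaluated at `z = s`.
    have h := norm_le_interp_of_mem_verticalClosedStrip' (f := f) (z := (s : ℂ))
      (a := C₀ * q) (b := C₁ * q) ht ⟨by simpa using hs, by simpa using hst⟩
      hdiff.diffContOnCl hbdd
      (fun z hz => hline C₀ z hC₀ (by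
        have hz : z.re = 0 := hz
        rw [hz]; exact h₀))
      (fun z hz => hline C₁ z hC₁ (by
        have hz : z.re = t := hz
        rw [hz]; exact h₁))
    rw [Complex.ofReal_re, sub_zero, sub_zero, ← hθ, Real.mul_rpow hC₀ hq0, Real.mul_rpow hC₁ hq0,
      mul_mul_mul_comm, ← Real.rpow_add_of_nonneg hq0 (by linarith) hθ0, sub_add_cancel,
      Real.rpow_one] at h
    exact h
  refine ell2_norm_le_of_sum_le (by positivity) fun A => ?_
  set c := sob s (G (trig B u)) with hc
  set X := ∑ ξ ∈ A, ‖c ξ‖ ^ 2 with hX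
  have hX0 : 0 ≤ X := Finset.sum_nonneg fun _ _ => by positivity
  -- The extremal choice: the form becomes `X` itself, and the bound reads `X ≤ const · √X · ‖sob s
  -- (trig B u)‖`.
  have h1 := key A (fun ξ => (starRingEnd ℂ) (c ξ)) (fun η => (bracket η : ℂ) ^ (s : ℂ) * u η)
  have e1 : (trig B fun η => (bracket η : ℂ) ^ (-(s : ℂ)) * ((bracket η : ℂ) ^ (s : ℂ) * u η)) =
      trig B u := by
    congr 1; funext η
    have : (bracket η : ℂ) ≠ 0 := by exact_mod_cast (bracket_pos η).ne'
    rw [← mul_assoc, ← Complex.cpow_add _ _ this]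
    simp
  have e2 : ∀ ξ, (bracket ξ : ℂ) ^ (s : ℂ) * coeff ξ (G (trig B u)) = c ξ := fun ξ => by
    rw [hc, sob_apply, Complex.ofReal_cpow (bracket_pos ξ).le]
  have e3 : ∑ η ∈ B, ‖(bracket η : ℂ) ^ (s : ℂ) * u η‖ ^ 2 = ‖sob s (trig B u)‖ ^ 2 := by
    rw [norm_sob_trig_sq]
    refine Finset.sum_congr rfl fun η _ => ?_
    rw [norm_mul, norm_bracket_cpow, Complex.ofReal_re]
  rw [e1] at h1
  simp only [e2, RCLike.norm_conj] at h1
  have e4 : ∑ ξ ∈ A, (starRingEnd ℂ) (c ξ) * c ξ = ((X : ℝ) : ℂ) := by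
    rw [hX, Complex.ofReal_sum]
    refine Finset.sum_congr rfl fun ξ _ => ?_
    rw [mul_comm, Complex.mul_conj, Complex.normSq_eq_norm_sq]
  rw [e4, Complex.norm_real, Real.norm_of_nonneg hX0, e3, Real.sqrt_sq (norm_nonneg _),
    mul_left_comm, ← hX] at h1
  have h2 : Real.sqrt X ≤ C₀ ^ (1 - θ) * C₁ ^ θ * ‖sob s (trig B u)‖ := by
    rcases hX0.eq_or_lt with h0 | h0
    · rw [← h0, Real.sqrt_zero]; positivity
    · have h3 : 0 < Real.sqrt X := Real.sqrt_pos.2 h0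
      refine le_of_mul_le_mul_left ?_ h3
      rwa [Real.mul_self_sqrt hX0]
  calc X = Real.sqrt X ^ 2 := (Real.sq_sqrt hX0).symm
    _ ≤ _ := by gcongr

/-- This makes the lower order remainder of the Lasota–Yorke inequality small on high frequencies.
-/
lemma norm_sob_le_of_high_frequency {φ : SmoothCircle} {N : ℕ} (hN : 0 < N)
    (h : ∀ n : ℤ, |n| ≤ N → coeff n φ = 0) (k : ℕ) :
    ‖sob k φ‖ ≤ (N : ℝ)⁻¹ * ‖sob (k + 1 : ℕ) φ‖ := by
  refine ell2_norm_le_mul (by positivity) fun n => ?_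
  rw [norm_sob_natCast_apply, norm_sob_natCast_apply]
  by_cases hn : |n| ≤ N
  · simp [h n hn]
  · have h1 : (N : ℝ) ≤ bracket n := by
      refine le_trans ?_ (abs_le_bracket n)
      push Not at hn
      exact_mod_cast hn.le
    have hN' : (0 : ℝ) < N := by exact_mod_cast hN
    rw [inv_mul_eq_div, le_div_iff₀ hN', pow_succ]
    have := (bracket_pos n).le
    calc bracket n ^ k * ‖coeff n φ‖ * N = bracket n ^ k * N * ‖coeff n φ‖ := by ring
      _ ≤ _ := by gcongr

/-! ### Bounds on real Sobolev exponents and their duals -/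

namespace ExpandingData

variable (S : ExpandingData) (ν : ℝ)

/-- The transposed operator is bounded on `H^s`. -/
lemma exists_norm_sob_transpose_trig_le {s : ℝ} (hs : 0 ≤ s) : ∃ C, 0 ≤ C ∧
    ∀ (B : Finset ℤ) (u : ℤ → ℂ),
      ‖sob s (S.transpose ν (trig B u))‖ ≤ C * ‖sob s (trig B u)‖ := by
  obtain ⟨C, hC, h⟩ := S.exists_norm_sob_transpose_le ν (⌈s⌉₊ + 1)
  have ht : (0 : ℝ) < ((⌈s⌉₊ + 1 : ℕ) : ℝ) := by positivity
  have hst : s ≤ ((⌈s⌉₊ + 1 : ℕ) : ℝ) := by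
    push_cast; linarith [Nat.le_ceil s]
  refine ⟨_, ?_, fun B u => norm_sob_interpolate (S.transpose ν) B hs hst ht
    (Real.sqrt_nonneg (S.k / S.Emin)) hC (fun u => S.norm_sob_zero_transpose_le ν _)
    (fun u => h _) u⟩
  positivity

/-- The gain `E_min^{-t}` is exponential in `t`, so its geometric interpolation at `θ = |m| / t` is
`E_min^{-|m|}` whatever `t` is. -/
lemma rm_eq {m : ℝ} (hm : m < 0) {t : ℕ} (ht : 0 < t) :
    Real.sqrt (S.k / S.Emin) ^ (1 - -m / t) *
      (Real.sqrt (S.k / S.Emin) * (S.Emin ^ t)⁻¹) ^ (-m / t) = S.rm m := by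
  have hE := S.Emin_pos
  have hk := S.k_pos
  have hr : 0 < Real.sqrt (S.k / S.Emin) := Real.sqrt_pos.2 (by positivity)
  have ht' : (t : ℝ) ≠ 0 := by positivity
  rw [Real.mul_rpow hr.le (by positivity), ← mul_assoc, ← Real.rpow_add hr, sub_add_cancel,
    Real.rpow_one, rm, abs_of_neg hm, Real.inv_rpow (by positivity), ← Real.rpow_natCast,
    ← Real.rpow_mul hE.le, mul_div_cancel₀ _ ht', one_div, mul_comm]

/-- The transposed operator has norm at most `ρ > r_m` on the trigonometric polynomials of high
frequencies, for the norm of `H^{-m}`. -/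
lemma exists_norm_sob_transpose_high_le {m ρ : ℝ} (hm : m < 0) (hρ : S.rm m < ρ) :
    ∃ N₀ : ℕ, ∀ N ≥ N₀, ∀ (B : Finset ℤ) (u : ℤ → ℂ), (∀ η ∈ B, (N : ℤ) < |η|) →
      ‖sob (-m) (S.transpose ν (trig B u))‖ ≤ ρ * ‖sob (-m) (trig B u)‖ := by
  set k := ⌈-m⌉₊ with hk
  have hE := S.Emin_pos
  obtain ⟨C, hC, h⟩ := S.exists_norm_sob_succ_transpose_le ν k (S.exists_norm_sob_transpose_le ν k)
  set q : ℝ := Real.sqrt (S.k / S.Emin) * (S.Emin ^ (k + 1))⁻¹ with hq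
  have hq0 : 0 < q := by
    have := S.k_pos
    have : 0 < Real.sqrt (S.k / S.Emin) := Real.sqrt_pos.2 (by positivity)
    positivity
  have ht : (0 : ℝ) < ((k + 1 : ℕ) : ℝ) := by positivity
  have hst : -m ≤ ((k + 1 : ℕ) : ℝ) := by
    push_cast; linarith [Nat.le_ceil (-m)]
  -- Above frequency `N` the `H^{k+1}` norm of the operator is at most `q + C / N`; as `N` grows the
  -- interpolated constant tends to `r_m < ρ`.
  have hcont : Filter.Tendsto (fun N : ℕ => Real.sqrt (S.k / S.Emin) ^ (1 - -m / (k + 1 : ℕ)) *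
      (q + C * (N : ℝ)⁻¹) ^ (-m / (k + 1 : ℕ))) Filter.atTop (nhds (S.rm m)) := by
    rw [← S.rm_eq hm (Nat.succ_pos k)]
    refine Filter.Tendsto.const_mul _ (Filter.Tendsto.rpow_const ?_ (Or.inl hq0.ne'))
    have h0 := ((tendsto_inv_atTop_nhds_zero_nat (𝕜 := ℝ)).const_mul C).const_add q
    rwa [mul_zero, add_zero] at h0
  obtain ⟨N₀, hN₀⟩ := Filter.eventually_atTop.1 (hcont.eventually_le_const hρ)
  refine ⟨max N₀ 1, fun N hN B u hB => ?_⟩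
  have hN1 : 0 < N := lt_of_lt_of_le one_pos ((le_max_right _ _).trans hN)
  have hN2 : N₀ ≤ N := (le_max_left _ _).trans hN
  refine (norm_sob_interpolate (S.transpose ν) B (s := -m) (t := (k + 1 : ℕ)) (by linarith) hst ht
    (Real.sqrt_nonneg (S.k / S.Emin)) (C₁ := q + C * (N : ℝ)⁻¹) (by positivity)
    (fun u => S.norm_sob_zero_transpose_le ν _) (fun u => ?_) u).trans ?_
  · rw [add_mul, mul_assoc C]
    refine (h _).trans ?_
    gcongr
    refine norm_sob_le_of_high_frequency hN1 (fun n hn => ?_) k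
    rw [coeff_trig, if_neg fun h' => (hB n h').not_ge hn]
  · gcongr
    exact hN₀ N hN2

/-- Duality: bounds of the transposed operator on trigonometric polynomials give bounds of the
Fourier coefficients of the images by the transfer operator. -/
lemma sum_weightedCoeff_transfer_le {m C : ℝ} (hC : 0 ≤ C) (s : Finset ℤ)
    (h : ∀ u : ℤ → ℂ, ‖sob (-m) (S.transpose ν (trig (s.map (Equiv.neg ℤ).toEmbedding) u))‖ ≤
      C * ‖sob (-m) (trig (s.map (Equiv.neg ℤ).toEmbedding) u)‖) (α : SobolevSpace m) :
    ∑ n ∈ s, ‖weightedCoeff m (S.transfer ν α) n‖ ^ 2 ≤ (C * ‖α‖) ^ 2 := by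
  set c := weightedCoeff m (S.transfer ν α) with hc
  set B := s.map (Equiv.neg ℤ).toEmbedding with hB
  set X := ∑ n ∈ s, ‖c n‖ ^ 2 with hX
  have hX0 : 0 ≤ X := Finset.sum_nonneg fun _ _ => by positivity
  have hce : ∀ n, c n = ((bracket n ^ m : ℝ) : ℂ) * α.1.1 (S.transpose ν (fourierMode (-n))) :=
    fun n => rfl
  -- Chosen so that the pairing equals `X` and the `H^{-m}` norm equals `√X`. The sign is reversed
  -- because the coefficient at `n` tests against the mode `-n`.
  set u : ℤ → ℂ := fun η => ((bracket η ^ m : ℝ) : ℂ) * (starRingEnd ℂ) (c (-η)) with hu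
  have h1 := h u
  have e1 : ‖sob (-m) (trig B u)‖ = Real.sqrt X := by
    rw [eq_comm, Real.sqrt_eq_iff_mul_self_eq hX0 (norm_nonneg _), ← sq, norm_sob_trig_sq, hB,
      Finset.sum_map]
    refine Finset.sum_congr rfl fun n _ => ?_
    have h2 := Real.rpow_pos_of_pos (bracket_pos n) m
    simp only [hu, Equiv.coe_toEmbedding, Equiv.neg_apply, neg_neg, bracket_neg]
    rw [norm_mul, RCLike.norm_conj, Complex.norm_real, Real.norm_of_nonneg h2.le,
      Real.rpow_neg (bracket_pos n).le, inv_mul_cancel_left₀ h2.ne']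
  have e2 : α.1.1 (S.transpose ν (trig B u)) = ((X : ℝ) : ℂ) := by
    rw [trig, map_sum, map_sum, hB, Finset.sum_map, hX, Complex.ofReal_sum]
    refine Finset.sum_congr rfl fun n _ => ?_
    rw [map_smul, map_smul, smul_eq_mul]
    simp only [hu, Equiv.coe_toEmbedding, Equiv.neg_apply, neg_neg, bracket_neg]
    rw [mul_right_comm, ← hce, Complex.mul_conj, Complex.normSq_eq_norm_sq]
  have h2 := norm_apply_le m α (S.transpose ν (trig B u))
  rw [e2, Complex.norm_real, Real.norm_of_nonneg hX0] at h2
  have h3 : X ≤ Real.sqrt X * (C * ‖α‖) := by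
    calc X ≤ ‖α‖ * (C * Real.sqrt X) := h2.trans (by rw [← e1]; gcongr)
      _ = _ := by ring
  have h4 : Real.sqrt X ≤ C * ‖α‖ := by
    rcases hX0.eq_or_lt with h0 | h0
    · rw [← h0, Real.sqrt_zero]; positivity
    · have h5 : 0 < Real.sqrt X := Real.sqrt_pos.2 h0
      refine le_of_mul_le_mul_left ?_ h5
      rwa [Real.mul_self_sqrt hX0]
  calc X = Real.sqrt X ^ 2 := (Real.sq_sqrt hX0).symm
    _ ≤ _ := by gcongr

lemma transfer_mem {m : ℝ} (hm : m < 0) (α : SobolevSpace m) :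
    S.transfer ν α ∈ SobolevSpace m := by
  obtain ⟨C, hC, h⟩ := S.exists_norm_sob_transpose_trig_le ν (s := -m) (by linarith)
  exact summable_of_sum_le (fun _ => by positivity) fun s =>
    S.sum_weightedCoeff_transfer_le ν hC s (fun u => h _ u) α

/-- The transfer operator on `H^m`. -/
def transferSobolev {m : ℝ} (hm : m < 0) : SobolevSpace m →L[ℂ] SobolevSpace m :=
  LinearMap.mkContinuousOfExistsBound
    ((S.transfer ν).restrict (p := SobolevSpace m) (q := SobolevSpace m)
      fun α hα => S.transfer_mem ν hm ⟨α, hα⟩) (by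
    obtain ⟨C, hC, h⟩ := S.exists_norm_sob_transpose_trig_le ν (s := -m) (by linarith)
    refine ⟨C, fun α => ?_⟩
    exact ell2_norm_le_of_sum_le (u := toEll2 m _) (by positivity) fun s =>
      S.sum_weightedCoeff_transfer_le ν hC s (fun u => h _ u) α)

lemma coe_transferSobolev {m : ℝ} (hm : m < 0) (α : SobolevSpace m) :
    (S.transferSobolev ν hm α : CircleDistribution) = S.transfer ν α := rfl

end ExpandingData

/-! ### Low frequency projections -/

lemma fourierCoefficient_ofSmooth (ψ : SmoothCircle) (n : ℤ) :
    fourierCoefficient (ofSmooth ψ) n = coeff n ψ := by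
  change ∫ x in (0 : ℝ)..1, ψ.1 x * (fourierMode (-n)).1 x =
    ∫ x in (0 : ℝ)..1, (fourierMode (-n)).1 x * ψ.1 x
  simp only [mul_comm]

/-- A smooth function as an element of `H^m`. -/
def sobolevOfSmooth (m : ℝ) (ψ : SmoothCircle) : SobolevSpace m :=
  ⟨ofSmooth ψ, (memlp_two_iff _).1 (by
    have h : weightedCoeff m (ofSmooth ψ) = fun n => ((bracket n ^ m : ℝ) : ℂ) * coeff n ψ :=
      funext fun n => congrArg (((bracket n ^ m : ℝ) : ℂ) * ·) (fourierCoefficient_ofSmooth ψ n)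
    rw [h]; exact memlp_sob m ψ)⟩

/-- The projection of a distribution to the frequencies `|n| ≤ N`. -/
def lowPass (m : ℝ) (N : ℕ) (α : CircleDistribution) : SobolevSpace m :=
  ∑ n ∈ Finset.Icc (-N : ℤ) N, fourierCoefficient α n • sobolevOfSmooth m (fourierMode n)

lemma coe_lowPass (m : ℝ) (N : ℕ) (α : CircleDistribution) :
    (lowPass m N α : CircleDistribution) =
      ∑ n ∈ Finset.Icc (-N : ℤ) N, fourierCoefficient α n • ofSmooth (fourierMode n) := by
  rw [lowPass, Submodule.coe_sum]
  rfl

lemma weightedCoeff_lowPass (m : ℝ) (N : ℕ) (α : CircleDistribution) (n : ℤ) :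
    weightedCoeff m (lowPass m N α) n = if |n| ≤ N then weightedCoeff m α n else 0 := by
  have h : ∀ k, weightedCoeff m (ofSmooth (fourierMode k)) n =
      if n = k then ((bracket n ^ m : ℝ) : ℂ) else 0 := fun k => by
    refine (congrArg (((bracket n ^ m : ℝ) : ℂ) * ·) (fourierCoefficient_ofSmooth _ n)).trans ?_
    simp [coeff_fourierMode]
  rw [coe_lowPass, map_sum, Finset.sum_apply]
  simp only [map_smul, Pi.smul_apply, h, smul_eq_mul, mul_ite, mul_zero]
  rw [Finset.sum_ite_eq]
  simp only [Finset.mem_Icc, ← abs_le]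
  refine if_congr Iff.rfl (mul_comm _ _) rfl

lemma lowPass_mem_span (m : ℝ) (N : ℕ) (α : CircleDistribution) :
    lowPass m N α ∈ Submodule.span ℂ
      ((fun n => sobolevOfSmooth m (fourierMode n)) '' (Finset.Icc (-N : ℤ) N : Set ℤ)) :=
  Submodule.sum_mem _ fun n hn => Submodule.smul_mem _ _ (Submodule.subset_span ⟨n, hn, rfl⟩)

/-- The linear map underlying `lowPass`. -/
def lowPassLinear (m : ℝ) (N : ℕ) : SobolevSpace m →ₗ[ℂ] SobolevSpace m where
  toFun α := lowPass m N α
  map_add' α β := by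
    simp only [lowPass, ← Finset.sum_add_distrib, ← add_smul]
    rfl
  map_smul' c α := by
    simp only [lowPass, Finset.smul_sum, smul_smul, RingHom.id_apply]
    rfl

/-- The low frequency projection on `H^m`. -/
def lowPassSobolev (m : ℝ) (N : ℕ) : SobolevSpace m →L[ℂ] SobolevSpace m :=
  (lowPassLinear m N).mkContinuous 1 fun α => by
    refine ell2_norm_le_mul (u := toEll2 m (lowPass m N α)) (v := toEll2 m α) zero_le_one
      fun n => ?_
    change ‖weightedCoeff m (lowPass m N α) n‖ ≤ 1 * ‖weightedCoeff m α n‖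
    rw [weightedCoeff_lowPass, one_mul]
    split_ifs
    · exact le_rfl
    · rw [norm_zero]; exact norm_nonneg _

lemma sobolevSpace_mono {m m' : ℝ} (h : m ≤ m') : SobolevSpace m' ≤ SobolevSpace m := by
  intro α hα
  refine Summable.of_nonneg_of_le (fun _ => by positivity) (fun n => ?_)
    (show Summable fun n => ‖weightedCoeff m' α n‖ ^ 2 from hα)
  change ‖((bracket n ^ m : ℝ) : ℂ) * fourierCoefficient α n‖ ^ 2 ≤
    ‖((bracket n ^ m' : ℝ) : ℂ) * fourierCoefficient α n‖ ^ 2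
  rw [norm_mul, norm_mul, Complex.norm_real, Complex.norm_real,
    Real.norm_of_nonneg (Real.rpow_nonneg (bracket_pos n).le _),
    Real.norm_of_nonneg (Real.rpow_nonneg (bracket_pos n).le _)]
  have h1 := Real.rpow_nonneg (bracket_pos n).le m
  gcongr
  exact one_le_bracket n

/-! ### The essential norm of the transfer operator -/

namespace ExpandingData

variable (S : ExpandingData) (ν : ℝ)

lemma rm_pos (m : ℝ) : 0 < S.rm m := by
  have hE := S.Emin_pos
  have hk := S.k_pos
  have hr : 0 < Real.sqrt (S.k / S.Emin) := Real.sqrt_pos.2 (by positivity)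
  rw [rm]
  positivity

/-- The transfer operator followed by a high frequency projection. -/
def transferHigh {m : ℝ} (hm : m < 0) (N : ℕ) : SobolevSpace m →L[ℂ] SobolevSpace m :=
  S.transferSobolev ν hm - lowPassSobolev m N ∘L S.transferSobolev ν hm

lemma transferHigh_apply {m : ℝ} (hm : m < 0) (N : ℕ) (α : SobolevSpace m) :
    S.transferHigh ν hm N α = S.transferSobolev ν hm α - lowPass m N (S.transfer ν α) := rfl

/-- Keeping only output frequencies above `N` means testing only against high frequency polynomials.
The bound for all `N ≥ N₀` lets two exponents share one cutoff. -/
lemma exists_norm_transferHigh_le {m ρ : ℝ} (hm : m < 0) (hρ : S.rm m < ρ) :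
    ∃ N₀ : ℕ, ∀ N ≥ N₀, ‖S.transferHigh ν hm N‖ ≤ ρ := by
  have hρ0 := (S.rm_pos m).trans hρ
  obtain ⟨N₀, h⟩ := S.exists_norm_sob_transpose_high_le ν hm hρ
  refine ⟨N₀, fun N hN => ContinuousLinearMap.opNorm_le_bound _ hρ0.le fun α => ?_⟩
  refine ell2_norm_le_of_sum_le (u := toEll2 m _) (by positivity) fun s => ?_
  have h1 : ∀ n, toEll2 m (S.transferHigh ν hm N α) n =
      if (N : ℤ) < |n| then weightedCoeff m (S.transfer ν α) n else 0 := fun n => by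
    have e : toEll2 m (S.transferHigh ν hm N α) n = weightedCoeff m (S.transfer ν α) n -
        weightedCoeff m (lowPass m N (S.transfer ν α)) n := by
      rw [transferHigh_apply, map_sub]; rfl
    rw [e, weightedCoeff_lowPass]
    by_cases hn : |n| ≤ N
    · simp [hn, hn.not_gt]
    · simp [hn, not_le.1 hn]
  have h2 := S.sum_weightedCoeff_transfer_le ν hρ0.le (s.filter fun n => (N : ℤ) < |n|)
    (fun u => h N hN _ u fun η hη => by
      obtain ⟨n, hn, rfl⟩ := Finset.mem_map.1 hη
      simpa using (Finset.mem_filter.1 hn).2) α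
  rw [Finset.sum_filter] at h2
  refine le_trans (le_of_eq (Finset.sum_congr rfl fun n _ => ?_)) h2
  rw [h1]
  split_ifs <;> simp

lemma essNormLE_transferSobolev {m : ℝ} (hm : m < 0) :
    EssNormLE (S.transferSobolev ν hm) (S.rm m) := by
  intro ρ hρ
  obtain ⟨N, hN⟩ := S.exists_norm_transferHigh_le ν hm hρ
  refine ⟨lowPassSobolev m N ∘L S.transferSobolev ν hm, ?_, hN N le_rfl⟩
  have := FiniteDimensional.span_of_finite ℂ
    ((Finset.Icc (-N : ℤ) N).finite_toSet.image fun n => sobolevOfSmooth m (fourierMode n))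
  refine Submodule.finiteDimensional_of_le (S₂ := Submodule.span ℂ
    ((fun n => sobolevOfSmooth m (fourierMode n)) '' (Finset.Icc (-N : ℤ) N : Set ℤ))) ?_
  rintro _ ⟨α, rfl⟩
  exact lowPass_mem_span m N _

/-! ### Independence of the Sobolev exponent -/

lemma coe_smul_sub_transferHigh {m : ℝ} (hm : m < 0) (N : ℕ) (z : ℂ) (x : SobolevSpace m) :
    ((z • x - S.transferHigh ν hm N x : SobolevSpace m) : CircleDistribution) =
      z • (x : CircleDistribution) - (S.transfer ν x - lowPass m N (S.transfer ν x)) := rfl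

lemma exists_smul_sub_transferHigh_eq {m : ℝ} (hm : m < 0) {N : ℕ} {z : ℂ}
    (hz : ‖S.transferHigh ν hm N‖ < ‖z‖) (γ : SobolevSpace m) :
    ∃ x, z • x - S.transferHigh ν hm N x = γ := by
  obtain ⟨U, hU⟩ := isUnit_smul_one_sub hz
  refine ⟨(↑U⁻¹ : SobolevSpace m →L[ℂ] SobolevSpace m) γ, ?_⟩
  have h := congrArg (fun A : SobolevSpace m →L[ℂ] SobolevSpace m => A γ) U.mul_inv
  rw [hU] at h
  exact h

lemma eq_of_smul_sub_transferHigh_eq {m : ℝ} (hm : m < 0) {N : ℕ} {z : ℂ}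
    (hz : ‖S.transferHigh ν hm N‖ < ‖z‖) {x y : SobolevSpace m}
    (h : z • x - S.transferHigh ν hm N x = z • y - S.transferHigh ν hm N y) : x = y := by
  obtain ⟨U, hU⟩ := isUnit_smul_one_sub hz
  have hinj : ∀ w, (↑U⁻¹ : SobolevSpace m →L[ℂ] SobolevSpace m)
      (z • w - S.transferHigh ν hm N w) = w := fun w => by
    have h := congrArg (fun A : SobolevSpace m →L[ℂ] SobolevSpace m => A w) U.inv_mul
    rw [hU] at h
    exact h
  rw [← hinj x, h, hinj]

/-- Regularity of the solutions of `(F - z) α = β` for `|z|` above the essential spectral radii. -/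
lemma mem_sobolevSpace_of_transfer_sub {m m' : ℝ} (hm : m < 0) (hm' : m' < 0) {z : ℂ}
    (hz : S.rm m < ‖z‖) (hz' : S.rm m' < ‖z‖) {α : CircleDistribution} (hα : α ∈ SobolevSpace m)
    (hβ : S.transfer ν α - z • α ∈ SobolevSpace m') : α ∈ SobolevSpace m' := by
  rcases le_total m' m with h | h
  · exact sobolevSpace_mono h hα
  obtain ⟨ρ, h1, h2⟩ := exists_between hz
  obtain ⟨ρ', h1', h2'⟩ := exists_between hz'
  -- With the same cutoff, the high frequency operators on the two spaces are restrictions of one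
  -- operator on distributions.
  obtain ⟨N₀, hN₀⟩ := S.exists_norm_transferHigh_le ν hm h1
  obtain ⟨N₀', hN₀'⟩ := S.exists_norm_transferHigh_le ν hm' h1'
  have hN := (hN₀ (max N₀ N₀') (le_max_left _ _)).trans_lt h2
  have hN' := (hN₀' (max N₀ N₀') (le_max_right _ _)).trans_lt h2'
  generalize max N₀ N₀' = N at hN hN'
  -- Writing `P` for the low frequency projection, `(z - (1 - P) F) α = P F α - (F - z) α`, and the
  -- right side lies in `H^{m'}`. Solve there; uniqueness in the larger space `H^m` identifies the
  -- solution with `α`.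
  obtain ⟨x', hx'⟩ := S.exists_smul_sub_transferHigh_eq ν hm' hN'
    (lowPass m' N (S.transfer ν α) - ⟨_, hβ⟩)
  have hx'' : z • (x' : CircleDistribution) -
      (S.transfer ν x' - lowPass m' N (S.transfer ν x')) =
      lowPass m' N (S.transfer ν α) - (S.transfer ν α - z • α) :=
    congrArg (fun y : SobolevSpace m' => (y : CircleDistribution)) hx'
  have hxα : (⟨x', sobolevSpace_mono h x'.2⟩ : SobolevSpace m) = ⟨α, hα⟩ := by
    refine S.eq_of_smul_sub_transferHigh_eq ν hm hN (Subtype.ext ?_)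
    rw [coe_smul_sub_transferHigh, coe_smul_sub_transferHigh, coe_lowPass, coe_lowPass]
    rw [coe_lowPass, coe_lowPass] at hx''
    rw [hx'']
    abel
  have : (x' : CircleDistribution) = α :=
    congrArg (fun y : SobolevSpace m => (y : CircleDistribution)) hxα
  rw [← this]; exact x'.2

lemma coe_transferSobolev_sub_pow {m : ℝ} (hm : m < 0) (z : ℂ) (j : ℕ) (α : SobolevSpace m) :
    (((((S.transferSobolev ν hm : SobolevSpace m →ₗ[ℂ] SobolevSpace m) -
      z • (1 : Module.End ℂ (SobolevSpace m))) ^ j) α : SobolevSpace m) : CircleDistribution) =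
      ((S.transfer ν - z • (1 : Module.End ℂ CircleDistribution)) ^ j) α := by
  induction j with
  | zero => rfl
  | succ j ih =>
    rw [pow_succ', pow_succ', Module.End.mul_apply, Module.End.mul_apply, ← ih]
    rfl

/-- The exponent enters only through membership in `H^m`; the nilpotency condition lives on
distributions. -/
lemma mem_map_genEigenspace {m : ℝ} (hm : m < 0) (z : ℂ) (α : CircleDistribution) :
    α ∈ (genEigenspace (S.transferSobolev ν hm) z).map (SobolevSpace m).subtype ↔
      α ∈ SobolevSpace m ∧
        ∃ j : ℕ, ((S.transfer ν - z • (1 : Module.End ℂ CircleDistribution)) ^ j) α = 0 := by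
  have key : ∀ x : SobolevSpace m, x ∈ genEigenspace (S.transferSobolev ν hm) z ↔
      ∃ j : ℕ, ((S.transfer ν - z • (1 : Module.End ℂ CircleDistribution)) ^ j)
        (x : CircleDistribution) = 0 := fun x => by
    rw [genEigenspace, Module.End.mem_maxGenEigenspace]
    refine exists_congr fun j => ?_
    rw [← coe_transferSobolev_sub_pow, Submodule.coe_eq_zero]
  rw [Submodule.mem_map]
  constructor
  · rintro ⟨x, hx, rfl⟩
    exact ⟨x.2, (key x).1 hx⟩
  · rintro ⟨h1, h2⟩
    exact ⟨⟨α, h1⟩, (key _).2 h2, rfl⟩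

/-- Induction on the order: `(F - z) α` has smaller order, so it lies in `H^{m'}`, and regularity
puts `α` there too. -/
lemma map_genEigenspace_le {m m' : ℝ} (hm : m < 0) (hm' : m' < 0) {z : ℂ}
    (hz : S.rm m < ‖z‖) (hz' : S.rm m' < ‖z‖) :
    (genEigenspace (S.transferSobolev ν hm) z).map (SobolevSpace m).subtype ≤
      (genEigenspace (S.transferSobolev ν hm') z).map (SobolevSpace m').subtype := by
  intro α hα
  rw [mem_map_genEigenspace] at *
  obtain ⟨h1, j, hj⟩ := hα
  refine ⟨?_, j, hj⟩
  induction j generalizing α with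
  | zero =>
    have : α = 0 := hj
    rw [this]; exact Submodule.zero_mem _
  | succ j ih =>
    rw [pow_succ, Module.End.mul_apply] at hj
    refine S.mem_sobolevSpace_of_transfer_sub ν hm hm' hz hz' h1 (ih ?_ hj)
    exact Submodule.sub_mem _ (S.transfer_mem ν hm ⟨α, h1⟩) (Submodule.smul_mem _ z h1)

lemma mem_spectrum_of_mem_spectrum {m m' : ℝ} (hm : m < 0) (hm' : m' < 0) {z : ℂ}
    (hz : S.rm m < ‖z‖) (hz' : S.rm m' < ‖z‖) (hs : z ∈ spectrum ℂ (S.transferSobolev ν hm)) :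
    z ∈ spectrum ℂ (S.transferSobolev ν hm') := by
  obtain ⟨x, hx⟩ := ((S.essNormLE_transferSobolev ν hm).hasEigenvalue hz hs).exists_hasEigenvector
  have h0 : S.transferSobolev ν hm x = z • x := hx.apply_eq_smul
  have h1 : S.transfer ν x = z • (x : CircleDistribution) := by
    rw [← S.coe_transferSobolev ν hm x, h0, Submodule.coe_smul]
  have h2 : (x : CircleDistribution) ∈ SobolevSpace m' := by
    refine S.mem_sobolevSpace_of_transfer_sub ν hm hm' hz hz' x.2 ?_
    rw [h1, sub_self]; exact Submodule.zero_mem _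
  have h3 : Module.End.HasEigenvector
      (S.transferSobolev ν hm' : SobolevSpace m' →ₗ[ℂ] SobolevSpace m') z ⟨x, h2⟩ := by
    have h4 : S.transferSobolev ν hm' ⟨x, h2⟩ = z • (⟨x, h2⟩ : SobolevSpace m') := by
      apply Subtype.ext
      rw [coe_transferSobolev, Submodule.coe_smul, h1]
    refine ⟨Module.End.mem_eigenspace_iff.2 h4, fun h5 => hx.2 ?_⟩
    rw [← Submodule.coe_eq_zero] at h5 ⊢
    exact h5
  rw [ContinuousLinearMap.spectrum_eq]
  exact (Module.End.hasEigenvalue_of_hasEigenvector h3).mem_spectrum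

end ExpandingData

end Ruelle
end

section

attribute [local instance] Ruelle.sobolevInner

/-- The three conclusions use the Hilbert structure of `H^m` in their proofs but only its norm in
their statements. -/
lemma Ruelle.ExpandingData.spectral_properties (S : Ruelle.ExpandingData) (ν : ℝ) {m : ℝ}
    (hm : m < 0) :
    (∃ R K : Ruelle.SobolevSpace m →L[ℂ] Ruelle.SobolevSpace m,
      S.transferSobolev ν hm = R + K ∧ IsCompactOperator K ∧ ‖R‖ ≤ S.rm m) ∧
    (∀ z ∈ spectrum ℂ (S.transferSobolev ν hm), S.rm m < ‖z‖ →
      Ruelle.IsDiscreteEigenvalue (S.transferSobolev ν hm) z) ∧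
    (∀ ρ : ℝ, S.rm m < ρ → (spectrum ℂ (S.transferSobolev ν hm) ∩ {z | ρ ≤ ‖z‖}).Finite) := by
  have h := S.essNormLE_transferSobolev ν hm
  exact ⟨h.exists_eq_add_compact (S.rm_pos m), fun z hs hz => h.isDiscreteEigenvalue hz hs,
    fun ρ hρ => h.finite_spectrum hρ⟩

end

theorem theorem1 (S : Ruelle.ExpandingData) (ν : ℝ) :
    ∃ F : ∀ m : ℝ, m < 0 → (Ruelle.SobolevSpace m →L[ℂ] Ruelle.SobolevSpace m),
      -- `F m` is the restriction of the transfer operator to `H^m`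
      (∀ (m : ℝ) (hm : m < 0) (α : Ruelle.SobolevSpace m),
        (F m hm α : Ruelle.CircleDistribution) = S.transfer ν α) ∧
      (∀ (m : ℝ) (hm : m < 0),
        (∃ R K : Ruelle.SobolevSpace m →L[ℂ] Ruelle.SobolevSpace m,
          F m hm = R + K ∧ IsCompactOperator K ∧ ‖R‖ ≤ S.rm m) ∧
        Ruelle.essentialSpectralRadius (F m hm) ≤ ENNReal.ofReal (S.rm m) ∧
        (∀ z ∈ spectrum ℂ (F m hm), S.rm m < ‖z‖ → Ruelle.IsDiscreteEigenvalue (F m hm) z) ∧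
        (∀ ρ : ℝ, S.rm m < ρ → (spectrum ℂ (F m hm) ∩ {z | ρ ≤ ‖z‖}).Finite)) ∧
      -- the resonances and their generalized eigenspaces do not depend on `m`
      (∀ (m m' : ℝ) (hm : m < 0) (hm' : m' < 0) (z : ℂ), S.rm m < ‖z‖ → S.rm m' < ‖z‖ →
        (z ∈ spectrum ℂ (F m hm) ↔ z ∈ spectrum ℂ (F m' hm')) ∧
        (Ruelle.genEigenspace (F m hm) z).map (Ruelle.SobolevSpace m).subtype =
          (Ruelle.genEigenspace (F m' hm') z).map (Ruelle.SobolevSpace m').subtype) := by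
  refine ⟨fun m hm => S.transferSobolev ν hm, fun m hm α => rfl, fun m hm => ?_,
    fun m m' hm hm' z hz hz' => ⟨⟨S.mem_spectrum_of_mem_spectrum ν hm hm' hz hz',
      S.mem_spectrum_of_mem_spectrum ν hm' hm hz' hz⟩,
      le_antisymm (S.map_genEigenspace_le ν hm hm' hz hz')
        (S.map_genEigenspace_le ν hm' hm hz' hz)⟩⟩
  obtain ⟨h1, h2, h3⟩ := S.spectral_properties ν hm
  exact ⟨h1, (S.essNormLE_transferSobolev ν hm).essentialSpectralRadius_le, h2, h3⟩
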